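/- Let $n\ge 0$, let $I\subseteq\mathbb R$ be an open interval (for instance $I=\mathbb R$), and for $t\in I$ let $\alpha_j=\alpha_j(t)\in\mathbb D=\{|z|<1\}$ $(0\le j\le n-1)$ and $\tau_n=\tau_n(t)\in\mathbb S^1=\{|z|=1\}$. Put $\rho_j=(1-|\alpha_j|^2)^{1/2}$, $\Theta_j=\begin{pmatrix}\overline{\alpha_j}&\rho_j\\ \rho_j&-\alpha_j\end{pmatrix}$, $G_j=\mathrm{diag}(I_j,\Theta_j,I_{n-j-1})$ for $0\le j\le n-1$, $G_n=\mathrm{diag}(I_n,\overline{\tau_n})$, and let $$G=G(t)=G_0G_1\cdots G_n ,$$ a unitary $(n+1)\times(n+1)$ upper Hessenberg matrix, which is assumed to be a differentiable function of $t\in I$. Its eigenvalues, which form the set $S=S(t)$, are the zeros of the paraorthogonal polynomial (POPUC) $P_{n+1}(z)=\det(z\,\mathrm I-G)$. Fix $\zeta\in\mathbb S^1$, a square root $\zeta^{1/2}$ of $\zeta$ with $\zeta^{-1/2}=\overline{\zeta^{1/2}}$, and a real number $p_0\neq0$, all independent of $t$. Whenever $\zeta\notin S(t)$ define $\tau_n(\zeta)=\tau_n$,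 $$\tau_j(\zeta)=\frac{\overline\zeta\,\alpha_j+\tau_{j+1}(\zeta)}{\overline{\alpha_j}\,\tau_{j+1}(\zeta)+\overline\zeta}\qquad (j=n-1,\dots,0),$$ and, with $\alpha_{-1}:=-1$, $$\beta_0=\frac1{\zeta^{-1/2}-\tau_0(\zeta)\,\zeta^{1/2}},\qquad \beta_{j+1}=\frac1{\beta_j}\cdot\frac1{\overline\zeta+\tau_j(\zeta)\overline{\alpha_{j-1}}}\cdot\frac1{1-\overline{\tau_j(\zeta)}\,\alpha_j}\qquad(j=0,\dots,n-1).$$ Let $p_{-1}(z)=0$, $p_0(z)=p_0$ and $p_{j+1}(z)=(\beta_j+\overline{\beta_j}\,z)\,p_j(z)-z\,p_{j-1}(z)$. Let $A$ be $\zeta^{1/2}$ times the lower bidiagonal matrix with diagonal $\overline{\beta_0},\dots,\overline{\beta_n}$ and all subdiagonal entries equal to $-1$, and put $H=(A+A^*)/2$, $K=(A-A^*)/(2i)$. (a) If $t\in I$ and $\zeta\notin S(t)$, then $H$ is positive definite at $t$, and $H^{-1/2}KH^{-1/2}$ is differentiable at $t$. (b) For every $t_0\in I$ and every $\eta_0\in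 S(t_0)$ there are an open interval $J$ with $t_0\in J\subseteq I$ and a continuous $\theta:J\to\mathbb R$ such that $\eta(t)=e^{i\theta(t)}$ is an eigenvalue of $G(t)$ for all $t\in J$ and $\eta(t_0)=\eta_0$. (c) Let $J\subseteq I$ be any open interval and let $\theta:J\to\mathbb R$ be any continuous function such that $\eta(t)=e^{i\theta(t)}$ is an eigenvalue of $G(t)$ for all $t\in J$. Then $\theta$ is differentiable on $J$, and for every $t\in J$ with $\zeta\notin S(t)$ the eigenvalue $\eta$ moves strictly counterclockwise along $\mathbb S^1$ at $t$, in the sense that $\theta'(t)>0$, if and only if $$\Big(\mathrm p,\;H^{1/2}\,\frac{\mathrm d}{\mathrm dt}\big(H^{-1/2}KH^{-1/2}\big)\,H^{1/2}\,\mathrm p\Big)<0 ,\qquad \mathrm p=\big(p_0(\eta),\dots,p_n(\eta)\big)^{\mathrm T},$$ where $(x,y)=\sum_i\overline{x_i}\,y_i$ and everything is taken at the time $t$. Moreover, if $T\subseteq J$ is an interval such that $\zeta\notin S(t)$ and this inequality holds for all $t\in T$, then $\theta$ is strictly increasing on $T$. -/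

import Mathlib

open scoped ComplexConjugate ComplexOrder MatrixOrder Topology

noncomputable section

namespace POPUC

/-- `ρ = (1 - |a|²)^{1/2}`. -/
def rho (a : ℂ) : ℝ := Real.sqrt (1 - ‖a‖ ^ 2)

/-- The `(n+1)`-by-`(n+1)` matrix `diag (I_j, Θ(a), I_{n-j-1})`, where
`Θ(a) = !![conj a, ρ; ρ, -a]` occupies the rows and columns `j` and `j + 1`
(numbered from `0`). -/
def givens (n j : ℕ) (a : ℂ) : Matrix (Fin (n + 1)) (Fin (n + 1)) ℂ :=
  Matrix.of fun r c =>
    if (r : ℕ) = j ∧ (c : ℕ) = j then conj a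
    else if (r : ℕ) = j ∧ (c : ℕ) = j + 1 then (rho a : ℂ)
    else if (r : ℕ) = j + 1 ∧ (c : ℕ) = j then (rho a : ℂ)
    else if (r : ℕ) = j + 1 ∧ (c : ℕ) = j + 1 then -a
    else if r = c then 1 else 0

/-- The matrix `diag (I_n, conj τ)`. -/
def lastFactor (n : ℕ) (τ : ℂ) : Matrix (Fin (n + 1)) (Fin (n + 1)) ℂ :=
  Matrix.diagonal fun i => if (i : ℕ) = n then conj τ else 1

/-- The unitary upper Hessenberg matrix `G(α_0, …, α_{n-1}, τ) = G_0 G_1 ⋯ G_{n-1} G_n`.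
Only the values `α 0, …, α (n - 1)` are used. -/
def matG (n : ℕ) (α : ℕ → ℂ) (τ : ℂ) : Matrix (Fin (n + 1)) (Fin (n + 1)) ℂ :=
  ((List.range n).map fun j => givens n j (α j)).prod * lastFactor n τ

/-- The paraorthogonal polynomial `P_{n+1}(z) = det (z I - G(α_0, …, α_{n-1}, τ))`. -/
def popuc (n : ℕ) (α : ℕ → ℂ) (τ : ℂ) : Polynomial ℂ := (matG n α τ).charpoly

/-- The pseudoreflection coefficients in reversed order: `tauRev n α τ ζ k = τ_{n-k}(ζ)`. -/
def tauRev (n : ℕ) (α : ℕ → ℂ) (τ ζ : ℂ) : ℕ → ℂ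
  | 0 => τ
  | k + 1 =>
    (conj ζ * α (n - 1 - k) + tauRev n α τ ζ k) /
      (conj (α (n - 1 - k)) * tauRev n α τ ζ k + conj ζ)

/-- The pseudoreflection coefficient `τ_j(ζ)`, for `0 ≤ j ≤ n`. -/
def tau (n : ℕ) (α : ℕ → ℂ) (τ ζ : ℂ) (j : ℕ) : ℂ := tauRev n α τ ζ (n - j)

theorem tau_last (n : ℕ) (α : ℕ → ℂ) (τ ζ : ℂ) : tau n α τ ζ n = τ := by
  simp [tau, tauRev]

theorem tau_of_lt (n : ℕ) (α : ℕ → ℂ) (τ ζ : ℂ) (j : ℕ) (hj : j < n) :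
    tau n α τ ζ j =
      (conj ζ * α j + tau n α τ ζ (j + 1)) / (conj (α j) * tau n α τ ζ (j + 1) + conj ζ) := by
  have h1 : n - j = (n - (j + 1)) + 1 := by omega
  have h2 : n - 1 - (n - (j + 1)) = j := by omega
  simp only [tau]
  rw [h1, tauRev, h2]

/-- The numbers `β_j(ζ)`, for `0 ≤ j ≤ n`; here `s` is the chosen square root of `ζ`, and
`α_{-1} = -1`. -/
def beta (n : ℕ) (α : ℕ → ℂ) (τ ζ s : ℂ) : ℕ → ℂ
  | 0 => 1 / (conj s - tau n α τ ζ 0 * s)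
  | j + 1 =>
    1 / beta n α τ ζ s j *
      (1 / (conj ζ + tau n α τ ζ j * conj (if j = 0 then -1 else α (j - 1)))) *
      (1 / (1 - conj (tau n α τ ζ j) * α j))

/-- The value at `z` of the polynomial `p_k(·, ζ)` generated from the coefficients `β` and the
constant `p_0` by `p_{k+1} = (β_k + conj β_k z) p_k - z p_{k-1}` with `p_{-1} = 0`. -/
def pVal (β : ℕ → ℂ) (p₀ : ℝ) (z : ℂ) : ℕ → ℂ
  | 0 => (p₀ : ℂ)
  | 1 => (β 0 + conj (β 0) * z) * (p₀ : ℂ)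
  | k + 2 => (β (k + 1) + conj (β (k + 1)) * z) * pVal β p₀ z (k + 1) - z * pVal β p₀ z k

/-- The vector `(p_0(z, ζ), …, p_n(z, ζ))`. -/
def pVec (n : ℕ) (α : ℕ → ℂ) (τ ζ s : ℂ) (p₀ : ℝ) (z : ℂ) : Fin (n + 1) → ℂ :=
  fun i => pVal (beta n α τ ζ s) p₀ z i

/-- The lower bidiagonal matrix `A`: `ζ^{1/2}` times the matrix with diagonal
`conj β_0, …, conj β_n` and subdiagonal entries `-1`. -/
def matA (n : ℕ) (α : ℕ → ℂ) (τ ζ s : ℂ) : Matrix (Fin (n + 1)) (Fin (n + 1)) ℂ :=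
  s • Matrix.of fun (i k : Fin (n + 1)) =>
    if i = k then conj (beta n α τ ζ s i) else if (i : ℕ) = (k : ℕ) + 1 then -1 else 0

/-- `H = (A + A*) / 2`. -/
def matH (n : ℕ) (α : ℕ → ℂ) (τ ζ s : ℂ) : Matrix (Fin (n + 1)) (Fin (n + 1)) ℂ :=
  (1 / 2 : ℂ) • (matA n α τ ζ s + (matA n α τ ζ s).conjTranspose)

/-- `K = (A - A*) / (2 i)`. -/
def matK (n : ℕ) (α : ℕ → ℂ) (τ ζ s : ℂ) : Matrix (Fin (n + 1)) (Fin (n + 1)) ℂ :=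
  (1 / (2 * Complex.I)) • (matA n α τ ζ s - (matA n α τ ζ s).conjTranspose)

/-- `H^{1/2}`, the positive square root of `H`. -/
def sqrtH (n : ℕ) (α : ℕ → ℂ) (τ ζ s : ℂ) : Matrix (Fin (n + 1)) (Fin (n + 1)) ℂ :=
  CFC.sqrt (matH n α τ ζ s)

/-- `H^{-1/2} K H^{-1/2}`. -/
def matX (n : ℕ) (α : ℕ → ℂ) (τ ζ s : ℂ) : Matrix (Fin (n + 1)) (Fin (n + 1)) ℂ :=
  (sqrtH n α τ ζ s)⁻¹ * matK n α τ ζ s * (sqrtH n α τ ζ s)⁻¹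

/-- The entrywise derivative at `t` of a matrix-valued function of a real variable. -/
def matDeriv {m : Type*} (M : ℝ → Matrix m m ℂ) (t : ℝ) : Matrix m m ℂ :=
  Matrix.of fun i k => deriv (fun u => M u i k) t

/-- The number `(p, H^{1/2} d/dt(H^{-1/2} K H^{-1/2}) H^{1/2} p)` at the time `t`, where
`p = (p_0(η, ζ), …, p_n(η, ζ))` and `(x, y) = ∑ conj x_i y_i`. -/
def form (n : ℕ) (α : ℝ → ℕ → ℂ) (τ : ℝ → ℂ) (ζ s : ℂ) (p₀ : ℝ) (η : ℂ) (t : ℝ) : ℂ :=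
  star (pVec n (α t) (τ t) ζ s p₀ η) ⬝ᵥ
    ((sqrtH n (α t) (τ t) ζ s * matDeriv (fun u => matX n (α u) (τ u) ζ s) t *
      sqrtH n (α t) (τ t) ζ s).mulVec (pVec n (α t) (τ t) ζ s p₀ η))

/-- `θ` is a continuous argument, on the set `J` of times, of an eigenvalue `t ↦ exp (i θ(t))`
on the unit circle of the matrices `M t`. -/
def IsEigenArg {m : Type*} [Fintype m] [DecidableEq m] (M : ℝ → Matrix m m ℂ) (J : Set ℝ)
    (θ : ℝ → ℝ) : Prop :=
  ContinuousOn θ J ∧ ∀ t ∈ J, Complex.exp (θ t * Complex.I) ∈ spectrum ℂ (M t)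

end POPUC

end

/-! The Cayley transform `λ = i(η + ζ)/(η - ζ)` carries the circle without `ζ` to the real line and
reverses orientation: `λ' = -2 θ' / |η - ζ|²`. It therefore suffices to realise `λ` as an eigenvalue
of a differentiable Hermitian family and to differentiate it by the Hellmann–Feynman formula.

The family is `X = H^{-1/2} K H^{-1/2}`. An eigenvector of `G` is generated by the Szegő recursion,
so `η` is an eigenvalue exactly when a paraorthogonal value vanishes (`mem_spectrum_matG_iff`). The
coefficients `τ_k(ζ)` turn the Szegő pairs into paraorthogonal values with a three-term recursion.
Up to nonzero factors this is the recursion of the `p_k` (`pVal_succ`), so `p_{n+1}(η) = 0` at an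
eigenvalue `η`. Read row by row, the recursion then says `A* p = -η ζ̄ A p`, that is, `K p = λ H p`
(`matK_mulVec_pVec`), and `v = H^{1/2} p` satisfies `X v = λ v`. Positivity of `H` comes from an
explicit factorization `H = Dᴴ D` (`matH_eq`).

Hence `λ' = (v, X' v)/(v, v)`, and the form of the criterion equals `-2 (v, v) θ' / |η - ζ|²`
(`exists_form_eq`). Differentiability of `X` uses the inverse function theorem for the matrix square
root and the recovery of `α_j`, `τ_n` from the first row of `G`. Existence and differentiability of
`θ` are proved on `G` itself, whose spectrum is simple, so they hold also when `ζ` is an eigenvalue.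
-/

namespace Matrix

/-! ### Differentiability of the matrix square root -/

variable {m : Type*} [Fintype m] [DecidableEq m]

/-- The Sylvester equation `R Z + Z R = 0` with positive definite `R` has only the zero solution. -/
theorem PosDef.eq_zero_of_mul_add_mul_eq_zero {R Z : Matrix m m ℂ} (hR : R.PosDef)
    (h : R * Z + Z * R = 0) : Z = 0 := by
  have h1 : (Zᴴ * R * Z).PosSemidef := hR.posSemidef.conjTranspose_mul_mul_same Z
  have h2 : (Z * R * Zᴴ).PosSemidef := hR.posSemidef.mul_mul_conjTranspose_same Z
  -- By cyclicity the sum is the trace of `Zᴴ (R Z + Z R)`. Both summands are nonnegative, so each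
  -- is zero.
  have h3 : (Zᴴ * R * Z).trace + (Z * R * Zᴴ).trace = 0 := by
    rw [Matrix.trace_mul_comm (Z * R) Zᴴ, Matrix.mul_assoc, ← Matrix.trace_add, ← Matrix.mul_add, h]
    simp
  have h4 : (Zᴴ * R * Z).trace = 0 :=
    ((add_eq_zero_iff_of_nonneg h1.trace_nonneg h2.trace_nonneg).1 h3).1
  have h5 : Zᴴ * R * Z = 0 := h1.trace_eq_zero_iff.1 h4
  by_contra hZ
  obtain ⟨x, hx⟩ : ∃ x, Z *ᵥ x ≠ 0 := by
    by_contra! hx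
    exact hZ (Matrix.ext_of_mulVec_single fun i => by rw [hx, Matrix.zero_mulVec])
  have h6 := hR.dotProduct_mulVec_pos hx
  have h7 : star (Z *ᵥ x) ⬝ᵥ (R *ᵥ (Z *ᵥ x)) = star x ⬝ᵥ ((Zᴴ * R * Z) *ᵥ x) := by
    rw [Matrix.star_mulVec, ← Matrix.dotProduct_mulVec, Matrix.mulVec_mulVec, Matrix.mulVec_mulVec,
      Matrix.mul_assoc]
  rw [h7, h5] at h6
  simp at h6

open scoped Matrix.Norms.L2Operator in
theorem differentiableAt_of_entries {M : ℝ → Matrix m m ℂ} {t : ℝ}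
    (h : ∀ i k, DifferentiableAt ℝ (fun u => M u i k) t) : DifferentiableAt ℝ M t := by
  have : M = fun u => ∑ i, ∑ k, (M u i k) • Matrix.single i k (1 : ℂ) := by
    funext u
    conv_lhs => rw [Matrix.matrix_eq_sum_single (M u)]
    simp [Matrix.smul_single]
  rw [this]
  exact DifferentiableAt.fun_sum fun i _ => DifferentiableAt.fun_sum fun k _ =>
    (h i k).smul_const _

open scoped Matrix.Norms.L2Operator in
theorem differentiableAt_entry {M : ℝ → Matrix m m ℂ} {t : ℝ} (h : DifferentiableAt ℝ M t)
    (i k : m) : DifferentiableAt ℝ (fun u => M u i k) t :=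
  (LinearMap.toContinuousLinearMap (Matrix.entryLinearMap ℝ ℂ i k)).differentiableAt.comp t h

open scoped Matrix.Norms.L2Operator in
-- Inverse function theorem for `x ↦ x * x` at `R = √(M t)`: its derivative `Z ↦ R Z + Z R` is
-- injective by the Sylvester lemma, hence invertible in finite dimension. The local inverse agrees
-- with `CFC.sqrt` along `M` because `CFC.sqrt` is continuous on the nonnegative cone, which keeps
-- `√(M u)` close to `R`.
theorem PosDef.differentiableAt_sqrt {M : ℝ → Matrix m m ℂ} {t : ℝ} (ht : (M t).PosDef)
    (hM : ∀ᶠ u in 𝓝 t, (M u).PosSemidef)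
    (hd : ∀ i k, DifferentiableAt ℝ (fun u => M u i k) t) (i k : m) :
    DifferentiableAt ℝ (fun u => CFC.sqrt (M u) i k) t := by
  have hMd := differentiableAt_of_entries hd
  set R := CFC.sqrt (M t) with hRdef
  have hR : R.PosDef := by
    have := (Matrix.isStrictlyPositive_iff_posDef.2 ht).sqrt
    exact Matrix.isStrictlyPositive_iff_posDef.1 this
  have hcont : ContinuousAt (fun u => CFC.sqrt (M u)) t := by
    have h1 := CFC.continuousOn_sqrt (A := Matrix m m ℂ) (M t)
      (Matrix.nonneg_iff_posSemidef.2 ht.posSemidef)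
    refine h1.tendsto.comp (tendsto_nhdsWithin_iff.2 ⟨hMd.continuousAt, ?_⟩)
    exact hM.mono fun u hu => Matrix.nonneg_iff_posSemidef.2 hu
  let L : Matrix m m ℂ →ₗ[ℝ] Matrix m m ℂ := LinearMap.mulLeft ℝ R + LinearMap.mulRight ℝ R
  have hL : Function.Injective L := by
    refine (injective_iff_map_eq_zero L).2 fun Z hZ => hR.eq_zero_of_mul_add_mul_eq_zero ?_
    simpa [L] using hZ
  let e : Matrix m m ℂ ≃L[ℝ] Matrix m m ℂ :=
    (LinearEquiv.ofInjectiveEndo L hL).toContinuousLinearEquiv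
  have hsq : HasStrictFDerivAt (fun x : Matrix m m ℂ => x * x)
      (e : Matrix m m ℂ →L[ℝ] Matrix m m ℂ) R := by
    have := (hasStrictFDerivAt_id (𝕜 := ℝ) R).mul' (hasStrictFDerivAt_id (𝕜 := ℝ) R)
    refine this.congr_fderiv ?_
    ext1 Z
    simp [e, L]
  have hinv := hsq.to_localInverse.hasFDerivAt.differentiableAt
  have hRR : R * R = M t := CFC.sqrt_mul_sqrt_self _ (Matrix.nonneg_iff_posSemidef.2 ht.posSemidef)
  simp only [hRR] at hinv
  have hcomp : DifferentiableAt ℝ (fun u => CFC.sqrt (M u)) t := by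
    refine (hinv.comp t hMd).congr_of_eventuallyEq ?_
    filter_upwards [hM, hcont.eventually hsq.eventually_left_inverse] with u hu hu2
    rw [CFC.sqrt_mul_sqrt_self _ (Matrix.nonneg_iff_posSemidef.2 hu)] at hu2
    exact hu2.symm
  exact differentiableAt_entry hcomp i k

end Matrix

namespace POPUC

open Matrix

/-! ### Action of `G` on vectors, its first row, and unitarity -/

theorem givens_mulVec {n j : ℕ} (hj : j < n) (a : ℂ) (f : ℕ → ℂ) :
    (givens n j a *ᵥ fun i : Fin (n + 1) => f i) = fun i : Fin (n + 1) =>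
      if (i : ℕ) = j then conj a * f j + rho a * f (j + 1)
      else if (i : ℕ) = j + 1 then rho a * f j - a * f (j + 1) else f i := by
  funext i
  have hsum : ∀ b c : ℂ, ∑ x : Fin (n + 1),
      ((if (x : ℕ) = j then b else 0) + (if (x : ℕ) = j + 1 then c else 0)) * f x =
        b * f j + c * f (j + 1) := by
    intro b c
    rw [Fin.sum_univ_eq_sum_range
      (fun x => ((if x = j then b else 0) + (if x = j + 1 then c else 0)) * f x)]
    simp only [add_mul, ite_mul, zero_mul, Finset.sum_add_distrib]
    rw [Finset.sum_ite_eq' , Finset.sum_ite_eq', if_pos (by simp; omega), if_pos (by simp; omega)]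
  simp only [Matrix.mulVec, dotProduct, givens, Matrix.of_apply]
  by_cases h1 : (i : ℕ) = j
  · rw [if_pos h1, ← hsum]
    refine Finset.sum_congr rfl fun x _ => ?_
    congr 1
    simp only [h1, true_and, Fin.ext_iff]
    split_ifs <;> first | omega | simp
  by_cases h2 : (i : ℕ) = j + 1
  · rw [if_neg h1, if_pos h2, sub_eq_add_neg, ← neg_mul, ← hsum]
    refine Finset.sum_congr rfl fun x _ => ?_
    congr 1
    simp only [h2, true_and, Fin.ext_iff]
    split_ifs <;> first | omega | simp
  · rw [if_neg h1, if_neg h2]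
    simp only [h1, h2, false_and, if_false, ite_mul, one_mul, zero_mul]
    simp

theorem lastFactor_mulVec (n : ℕ) (τ : ℂ) (f : ℕ → ℂ) :
    (lastFactor n τ *ᵥ fun i : Fin (n + 1) => f i) = fun i : Fin (n + 1) =>
      if (i : ℕ) = n then conj τ * f n else f i := by
  funext i
  rw [lastFactor, Matrix.mulVec_diagonal]
  split_ifs with h <;> simp [h]

/-- The action of `G` on a vector, computed from the intermediate quantities `u`. -/
theorem matG_mulVec {n : ℕ} {α : ℕ → ℂ} {τ : ℂ} {x u : ℕ → ℂ} (hn : u n = conj τ * x n)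
    (hu : ∀ j < n, u j = conj (α j) * x j + rho (α j) * u (j + 1)) :
    (matG n α τ *ᵥ fun i : Fin (n + 1) => x i) = fun i : Fin (n + 1) =>
      if (i : ℕ) = 0 then u 0
      else rho (α (i - 1)) * x (i - 1) - α (i - 1) * u i := by
  -- The vector on the left is what `G_k ⋯ G_n` makes of `x`: entries before `k` are untouched,
  -- entry `k` is `u k`, later entries are final.
  have key : ∀ k ≤ n, (((List.range k).map fun j => givens n j (α j)).prod *ᵥ
      fun i : Fin (n + 1) => if (i : ℕ) < k then x i else if (i : ℕ) = k then u k
        else rho (α (i - 1)) * x (i - 1) - α (i - 1) * u i) = fun i : Fin (n + 1) =>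
      if (i : ℕ) = 0 then u 0
      else rho (α (i - 1)) * x (i - 1) - α (i - 1) * u i := by
    intro k
    induction k with
    | zero => intro _; simp
    | succ k ih =>
      intro hk
      rw [← ih (by omega), List.range_succ, List.map_append, List.prod_append,
        ← Matrix.mulVec_mulVec]
      congr 1
      simp only [List.map_cons, List.map_nil, List.prod_cons, List.prod_nil, mul_one]
      rw [givens_mulVec (by omega) (α k) (fun i => if i < k + 1 then x i else if i = k + 1 then
        u (k + 1) else rho (α (i - 1)) * x (i - 1) - α (i - 1) * u i)]
      funext i
      by_cases h1 : (i : ℕ) = k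
      · simp [h1, hu k (by omega)]
      by_cases h2 : (i : ℕ) = k + 1
      · simp [h2]
      · by_cases h3 : (i : ℕ) < k
        · simp [h1, h2, h3, show (i : ℕ) < k + 1 by omega]
        · simp [h1, h2, h3, show ¬ (i : ℕ) < k + 1 by omega]
  rw [← key n le_rfl, matG, ← Matrix.mulVec_mulVec, lastFactor_mulVec n τ x]
  congr 1
  funext i
  by_cases h : (i : ℕ) = n
  · simp [h, hn]
  · simp [h, show (i : ℕ) < n by omega]

/-- Obtained by solving the recursion for `u` with `x` a unit vector. Its use is that the columns,
taken in order, reveal `α_0`, `α_1`, … and finally `τ`. -/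
theorem matG_zero_row {n : ℕ} (α : ℕ → ℂ) (τ : ℂ) (c : Fin (n + 1)) :
    matG n α τ 0 c = (∏ i ∈ Finset.range c, (rho (α i) : ℂ)) *
      (if (c : ℕ) = n then conj τ else conj (α c)) := by
  have hc : (c : ℕ) ≤ n := by omega
  have h := matG_mulVec (n := n) (α := α) (τ := τ) (x := fun i => if i = (c : ℕ) then 1 else 0)
    (u := fun j => if j ≤ (c : ℕ) then (∏ i ∈ Finset.Ico j c, (rho (α i) : ℂ)) *
      (if (c : ℕ) = n then conj τ else conj (α c)) else 0) ?_ ?_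
  · have h0 := congrFun h 0
    simp only [Fin.val_zero, if_true, zero_le, Finset.range_eq_Ico] at h0 ⊢
    rw [← h0]
    simp [Matrix.mulVec, dotProduct, ← Fin.ext_iff]
  · by_cases h : (c : ℕ) = n
    · simp [h]
    · simp [show ¬ n ≤ (c : ℕ) by omega, show ¬ n = (c : ℕ) by omega]
  · intro j hj
    rcases lt_trichotomy j (c : ℕ) with h | h | h
    · simp only [h.le, if_true, h.ne, if_false, mul_zero, zero_add, Nat.succ_le_of_lt h]
      rw [Finset.prod_eq_prod_Ico_succ_bot h, mul_assoc]
    · simp [← h, hj.ne]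
    · simp [show ¬ j ≤ (c : ℕ) by omega, show ¬ j + 1 ≤ (c : ℕ) by omega, h.ne']

theorem rho_sq {a : ℂ} (ha : ‖a‖ < 1) : (rho a : ℂ) ^ 2 = 1 - a * conj a := by
  rw [rho, ← Complex.ofReal_pow, Real.sq_sqrt (by nlinarith [norm_nonneg a]), Complex.mul_conj,
    Complex.normSq_eq_norm_sq]
  push_cast
  ring

theorem rho_pos {a : ℂ} (ha : ‖a‖ < 1) : 0 < rho a :=
  Real.sqrt_pos.2 (by nlinarith [norm_nonneg a])

theorem rho_ne_zero {a : ℂ} (ha : ‖a‖ < 1) : (rho a : ℂ) ≠ 0 :=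
  Complex.ofReal_ne_zero.2 (rho_pos ha).ne'

theorem rho_conj (a : ℂ) : rho (conj a) = rho a := by simp [rho]

theorem givens_conjTranspose (n j : ℕ) (a : ℂ) : (givens n j a)ᴴ = givens n j (conj a) := by
  ext r c
  simp only [Matrix.conjTranspose_apply, givens, Matrix.of_apply, rho_conj]
  by_cases h : r = c
  · subst h
    split_ifs <;> first | omega | simp
  · have h' : (r : ℕ) ≠ c := fun e => h (Fin.ext e)
    simp only [h, Ne.symm h, if_false]
    split_ifs <;> first | omega | simp

theorem givens_mem_unitary {n j : ℕ} (hj : j < n) {a : ℂ} (ha : ‖a‖ < 1) :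
    givens n j a ∈ Matrix.unitaryGroup (Fin (n + 1)) ℂ := by
  rw [Matrix.mem_unitaryGroup_iff', Matrix.star_eq_conjTranspose, givens_conjTranspose]
  refine Matrix.ext_of_mulVec_single fun k => ?_
  have hs : (Pi.single k 1 : Fin (n + 1) → ℂ) = fun i : Fin (n + 1) =>
      (fun l : ℕ => if l = (k : ℕ) then (1 : ℂ) else 0) i := by
    funext i
    simp [Pi.single_apply, Fin.ext_iff]
  rw [hs, ← Matrix.mulVec_mulVec, Matrix.one_mulVec]
  generalize (fun l : ℕ => if l = (k : ℕ) then (1 : ℂ) else 0) = f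
  rw [givens_mulVec hj a f]
  rw [givens_mulVec hj (conj a) (fun i => if i = j then conj a * f j + rho a * f (j + 1)
      else if i = j + 1 then rho a * f j - a * f (j + 1) else f i)]
  have h := rho_sq ha
  funext i
  by_cases h1 : (i : ℕ) = j
  · simp only [h1, if_true, rho_conj, Complex.conj_conj, Nat.succ_ne_self, if_false]
    linear_combination f j * h
  by_cases h2 : (i : ℕ) = j + 1
  · simp only [h2, if_true, rho_conj, Nat.succ_ne_self, if_false]
    linear_combination f (j + 1) * h
  · simp [h1, h2]

theorem mul_conj_eq_one {τ : ℂ} (h : ‖τ‖ = 1) : τ * conj τ = 1 := by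
  rw [Complex.mul_conj, Complex.normSq_eq_norm_sq, h]; simp

theorem lastFactor_mem_unitary (n : ℕ) {τ : ℂ} (hτ : ‖τ‖ = 1) :
    lastFactor n τ ∈ Matrix.unitaryGroup (Fin (n + 1)) ℂ := by
  rw [Matrix.mem_unitaryGroup_iff', Matrix.star_eq_conjTranspose, lastFactor,
    Matrix.diagonal_conjTranspose, Matrix.diagonal_mul_diagonal, ← Matrix.diagonal_one]
  congr 1
  funext i
  have := mul_conj_eq_one hτ
  by_cases h : (i : ℕ) = n <;> simp [h, this]

theorem matG_mem_unitary {n : ℕ} {α : ℕ → ℂ} {τ : ℂ} (hα : ∀ j < n, ‖α j‖ < 1) (hτ : ‖τ‖ = 1) :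
    matG n α τ ∈ Matrix.unitaryGroup (Fin (n + 1)) ℂ := by
  refine mul_mem (list_prod_mem fun M hM => ?_) (lastFactor_mem_unitary n hτ)
  obtain ⟨j, hj, rfl⟩ := List.mem_map.1 hM
  exact givens_mem_unitary (List.mem_range.1 hj) (hα j (List.mem_range.1 hj))

/-! ### Szegő recursion and the spectrum of `G` -/

/-- The pairs `(z Φ_k(z), Φ_k^*(z))` of the Szegő recursion. -/
def szego (α : ℕ → ℂ) (z : ℂ) : ℕ → ℂ × ℂ
  | 0 => (z, 1)
  | k + 1 => (z * ((szego α z k).1 - conj (α k) * (szego α z k).2),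
      (szego α z k).2 - α k * (szego α z k).1)

/-- The values `z Φ_k(z) - conj σ Φ_k^*(z)` of a paraorthogonal polynomial. -/
def paraVal (α : ℕ → ℂ) (σ z : ℂ) (k : ℕ) : ℂ := (szego α z k).1 - conj σ * (szego α z k).2

/-- The eigenvector of `G` belonging to an eigenvalue `z`, with first component `1`. -/
noncomputable def eigVec (α : ℕ → ℂ) (z : ℂ) (j : ℕ) : ℂ :=
  (szego α z j).2 / (z ^ j * ∏ i ∈ Finset.range j, (rho (α i) : ℂ))

/-- With `u_j = z Φ_j / (z^j ∏ ρ_i)`, the relations of `matG_mulVec` become the Szegő recursion, and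
the end condition `u n = conj τ * x n` becomes the vanishing of the paraorthogonal value. -/
theorem matG_mulVec_eigVec {n : ℕ} {α : ℕ → ℂ} {τ z : ℂ} (hα : ∀ j < n, ‖α j‖ < 1) (hz : z ≠ 0)
    (h : paraVal α τ z n = 0) :
    (matG n α τ *ᵥ fun i : Fin (n + 1) => eigVec α z i) =
      z • fun i : Fin (n + 1) => eigVec α z i := by
  have hR : ∀ k ≤ n, ∏ i ∈ Finset.range k, (rho (α i) : ℂ) ≠ 0 := fun k hk =>
    Finset.prod_ne_zero_iff.2 fun i hi => rho_ne_zero (hα i (by simp at hi; omega))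
  rw [matG_mulVec (u := fun j => (szego α z j).1 / (z ^ j * ∏ i ∈ Finset.range j, (rho (α i) : ℂ)))]
  · funext i
    by_cases hi : (i : ℕ) = 0
    · simp [hi, szego, eigVec]
    · obtain ⟨k, hk⟩ : ∃ k, (i : ℕ) = k + 1 := ⟨i - 1, by omega⟩
      have hkn : k < n := by omega
      have h1 := rho_ne_zero (hα k hkn)
      have h2 := hR k hkn.le
      have h3 := rho_sq (hα k hkn)
      simp only [hk, Nat.succ_ne_zero, if_false, Pi.smul_apply, smul_eq_mul, eigVec, Nat.add_sub_cancel, szego,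
        Finset.prod_range_succ, pow_succ]
      field_simp
      rw [h3]
      ring
  · have : (szego α z n).1 = conj τ * (szego α z n).2 := sub_eq_zero.1 h
    rw [this, eigVec, mul_div_assoc]
  · intro k hk
    have h1 := rho_ne_zero (hα k hk)
    have h2 := hR k hk.le
    simp only [eigVec, szego, Finset.prod_range_succ, pow_succ]
    field_simp
    ring

/-- For any eigenvector the pairs `(u_k, x_k)`, suitably scaled, obey the Szegő recursion with
initial value `x_0 (z, 1)`. So the vector is determined by `x_0`, and the end condition at `n` gives
the claim. -/
theorem paraVal_eq_zero_of_mulVec {n : ℕ} {α : ℕ → ℂ} {τ z : ℂ} (hα : ∀ j < n, ‖α j‖ < 1)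
    (hz : z ≠ 0) {x : ℕ → ℂ} (hx : ∃ i ≤ n, x i ≠ 0)
    (h : (matG n α τ *ᵥ fun i : Fin (n + 1) => x i) = z • fun i : Fin (n + 1) => x i) :
    paraVal α τ z n = 0 := by
  -- The recursion for `u` runs downwards from `n`, so it is defined by recursion on `n - j`.
  obtain ⟨u, hun, hu⟩ : ∃ u : ℕ → ℂ, u n = conj τ * x n ∧
      ∀ j < n, u j = conj (α j) * x j + rho (α j) * u (j + 1) := by
    refine ⟨fun j => Nat.rec (conj τ * x n)
      (fun k v => conj (α (n - 1 - k)) * x (n - 1 - k) + rho (α (n - 1 - k)) * v) (n - j),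
      by simp, fun j hj => ?_⟩
    have h1 : n - j = (n - (j + 1)) + 1 := by omega
    have h2 : n - 1 - (n - (j + 1)) = j := by omega
    simp only [h1, h2]
  rw [matG_mulVec hun hu] at h
  have h0 : u 0 = z * x 0 := by simpa using congrFun h 0
  have hs : ∀ j < n, rho (α j) * x j - α j * u (j + 1) = z * x (j + 1) := fun j hj => by
    simpa using congrFun h ⟨j + 1, by omega⟩
  set R : ℕ → ℂ := fun k => z ^ k * ∏ i ∈ Finset.range k, (rho (α i) : ℂ) with hRdef
  have hR : ∀ k ≤ n, R k ≠ 0 := fun k hk => mul_ne_zero (pow_ne_zero _ hz) <|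
    Finset.prod_ne_zero_iff.2 fun i hi => rho_ne_zero (hα i (by simp at hi; omega))
  have key : ∀ k ≤ n, R k * x k = x 0 * (szego α z k).2 ∧ R k * u k = x 0 * (szego α z k).1 := by
    intro k
    induction k with
    | zero => intro _; simp [hRdef, szego, h0, mul_comm]
    | succ k ih =>
      intro hk
      obtain ⟨i1, i2⟩ := ih (by omega)
      have e1 := hs k (by omega)
      have e2 := hu k (by omega)
      have e3 := rho_sq (hα k (by omega))
      have e4 : R (k + 1) = R k * (z * rho (α k)) := by
        simp only [hRdef, Finset.prod_range_succ, pow_succ]; ring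
      simp only [szego]
      constructor
      · rw [e4]
        linear_combination (-R k * rho (α k)) * e1 + R k * α k * e2 + i1 - α k * i2 +
          R k * x k * e3
      · rw [e4]
        linear_combination (-R k * z) * e2 + z * i2 - z * conj (α k) * i1
  have hx0 : x 0 ≠ 0 := by
    rintro hx0
    obtain ⟨i, hi, hxi⟩ := hx
    have := (key i hi).1
    rw [hx0, zero_mul] at this
    exact hxi ((mul_eq_zero.1 this).resolve_left (hR i hi))
  obtain ⟨k1, k2⟩ := key n le_rfl
  refine (mul_eq_zero.1 (?_ : x 0 * paraVal α τ z n = 0)).resolve_left hx0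
  rw [paraVal]
  linear_combination R n * hun - k2 + conj τ * k1

theorem mem_spectrum_iff_exists {m : Type*} [Fintype m] [DecidableEq m] {M : Matrix m m ℂ} {z : ℂ} :
    z ∈ spectrum ℂ M ↔ ∃ x ≠ 0, M *ᵥ x = z • x := by
  rw [← Matrix.spectrum_toLin', ← Module.End.hasEigenvalue_iff_mem_spectrum]
  constructor
  · intro h
    obtain ⟨v, hv⟩ := h.exists_hasEigenvector
    exact ⟨v, hv.2, by simpa using hv.apply_eq_smul⟩
  · rintro ⟨x, hx, h⟩
    exact Module.End.hasEigenvalue_of_hasEigenvector (x := x)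
      (Module.End.hasEigenvector_iff.2 ⟨Module.End.mem_eigenspace_iff.2 (by simpa using h), hx⟩)

theorem mem_spectrum_matG_iff {n : ℕ} {α : ℕ → ℂ} {τ z : ℂ} (hα : ∀ j < n, ‖α j‖ < 1)
    (hz : z ≠ 0) : z ∈ spectrum ℂ (matG n α τ) ↔ paraVal α τ z n = 0 := by
  rw [mem_spectrum_iff_exists]
  constructor
  · rintro ⟨x, hx, h⟩
    have hxe : x = fun i : Fin (n + 1) =>
        (fun k : ℕ => if hk : k < n + 1 then x ⟨k, hk⟩ else 0) i := by
      funext i; simp [show (i : ℕ) < n + 1 from i.2]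
    obtain ⟨i, hi⟩ := Function.ne_iff.1 hx
    rw [hxe] at h
    exact paraVal_eq_zero_of_mulVec hα hz (x := fun k => if hk : k < n + 1 then x ⟨k, hk⟩ else 0)
      ⟨i, by omega, by rw [dif_pos i.2]; exact hi⟩ h
  · intro h
    refine ⟨_, fun h0 => ?_, matG_mulVec_eigVec hα hz h⟩
    simpa [eigVec, szego] using congrFun h0 0

theorem star_mulVec_of_unitary {m : Type*} [Fintype m] [DecidableEq m] {M : Matrix m m ℂ}
    (hM : M ∈ Matrix.unitaryGroup m ℂ) {x : m → ℂ} {z : ℂ} (h : M *ᵥ x = z • x) :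
    x = z • (Mᴴ *ᵥ x) := by
  rw [← Matrix.mulVec_smul, ← h, Matrix.mulVec_mulVec, ← Matrix.star_eq_conjTranspose,
    Matrix.mem_unitaryGroup_iff'.1 hM, Matrix.one_mulVec]

theorem norm_eq_one_of_mem_spectrum {m : Type*} [Fintype m] [DecidableEq m] {M : Matrix m m ℂ}
    (hM : M ∈ Matrix.unitaryGroup m ℂ) {z : ℂ} (hz : z ∈ spectrum ℂ M) : ‖z‖ = 1 := by
  obtain ⟨x, hx, h⟩ := mem_spectrum_iff_exists.1 hz
  have h1 : star (M *ᵥ x) ⬝ᵥ (M *ᵥ x) = star x ⬝ᵥ x := by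
    rw [Matrix.star_mulVec, ← Matrix.dotProduct_mulVec, Matrix.mulVec_mulVec,
      ← Matrix.star_eq_conjTranspose, Matrix.mem_unitaryGroup_iff'.1 hM, Matrix.one_mulVec]
  have hx0 : star x ⬝ᵥ x ≠ 0 := fun h => hx (dotProduct_star_self_eq_zero.1 h)
  rw [h, star_smul, smul_dotProduct, dotProduct_smul, smul_smul, smul_eq_mul] at h1
  have h2 : star z * z = 1 := mul_right_cancel₀ hx0 (by rw [h1, one_mul])
  have h3 : ‖star z * z‖ = 1 := by rw [h2]; simp
  rw [norm_mul, norm_star] at h3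
  nlinarith [norm_nonneg z]

/-- Follows from `Mᴴ = M⁻¹` and `z⁻¹ = conj z`. It serves twice: for the orthogonality of
eigenvectors with distinct eigenvalues, and as the left-eigenvector hypothesis in
`hasDerivAt_eigenvalue`. -/
theorem star_vecMul_of_unitary {m : Type*} [Fintype m] [DecidableEq m] {M : Matrix m m ℂ}
    (hM : M ∈ Matrix.unitaryGroup m ℂ) {x : m → ℂ} {z : ℂ} (hz : ‖z‖ = 1)
    (h : M *ᵥ x = z • x) (y : m → ℂ) : star x ⬝ᵥ (M *ᵥ y) = z * (star x ⬝ᵥ y) := by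
  have h1 : Mᴴ *ᵥ x = conj z • x := by
    conv_rhs => rw [star_mulVec_of_unitary hM h]
    rw [smul_smul, mul_comm, mul_conj_eq_one hz, one_smul]
  have h2 : star x ᵥ* M = z • star x := by
    have := congrArg star h1
    rw [Matrix.star_mulVec, Matrix.conjTranspose_conjTranspose] at this
    simpa [star_smul] using this
  rw [Matrix.dotProduct_mulVec, h2, smul_dotProduct, smul_eq_mul]

/-! ### Pseudoreflection coefficients and recursions for paraorthogonal values -/

section Coefficients

variable {n : ℕ} {α : ℕ → ℂ} {τ ζ s : ℂ}

theorem conj_mul_add_ne_zero {a b c : ℂ} (ha : ‖a‖ < 1) (hb : ‖b‖ = 1) (hc : ‖c‖ = 1) :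
    conj a * b + conj c ≠ 0 := by
  intro h
  have h1 : ‖conj a * b‖ = ‖conj c‖ := by rw [eq_neg_of_add_eq_zero_left h, norm_neg]
  rw [norm_mul, RCLike.norm_conj, RCLike.norm_conj, hb, hc, mul_one] at h1
  exact ha.ne h1

theorem norm_tau (hα : ∀ j < n, ‖α j‖ < 1) (hτ : ‖τ‖ = 1) (hζ : ‖ζ‖ = 1) (j : ℕ) :
    ‖tau n α τ ζ j‖ = 1 := by
  rw [tau]
  have hle : n - j ≤ n := Nat.sub_le _ _
  generalize n - j = k at hle
  induction k with
  | zero => simpa [tauRev]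
  | succ k ih =>
    have ih := ih (by omega)
    have ha := hα (n - 1 - k) (by omega)
    rw [tauRev]
    set a := α (n - 1 - k)
    set b := tauRev n α τ ζ k
    have hne := conj_mul_add_ne_zero ha ih hζ
    -- The numerator is a unimodular multiple of the conjugate of the denominator.
    have h1 : conj ζ * a + b = conj ζ * b * conj (conj a * b + conj ζ) := by
      simp only [map_add, map_mul, Complex.conj_conj]
      linear_combination (-conj ζ * a) * mul_conj_eq_one ih - b * mul_conj_eq_one hζ
    rw [norm_div, h1, norm_mul, norm_mul, RCLike.norm_conj, RCLike.norm_conj, ih, hζ, one_mul,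
      one_mul, div_self (norm_ne_zero_iff.2 hne)]

variable (n α τ ζ) in
/-- The denominators `1 - conj τ_k(ζ) α_k`. -/
noncomputable def gap (k : ℕ) : ℂ := 1 - conj (tau n α τ ζ k) * α k

theorem gap_ne_zero (hα : ∀ j < n, ‖α j‖ < 1) (hτ : ‖τ‖ = 1) (hζ : ‖ζ‖ = 1) {k : ℕ} (hk : k < n) :
    gap n α τ ζ k ≠ 0 := by
  intro h
  have h1 : ‖conj (tau n α τ ζ k) * α k‖ = 1 := by rw [← sub_eq_zero.1 h, norm_one]
  rw [norm_mul, RCLike.norm_conj, norm_tau hα hτ hζ, one_mul] at h1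
  exact (hα k hk).ne h1

theorem tau_mul_conj (hα : ∀ j < n, ‖α j‖ < 1) (hτ : ‖τ‖ = 1) (hζ : ‖ζ‖ = 1) (k : ℕ) :
    tau n α τ ζ k * conj (tau n α τ ζ k) = 1 := mul_conj_eq_one (norm_tau hα hτ hζ k)

/-- The recursion for `τ_k` solved for `τ_{k+1}` and conjugated, free of denominators. -/
theorem conj_tau_succ_mul_gap (hα : ∀ j < n, ‖α j‖ < 1) (hτ : ‖τ‖ = 1) (hζ : ‖ζ‖ = 1) {k : ℕ}
    (hk : k < n) : conj (tau n α τ ζ (k + 1)) * gap n α τ ζ k =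
      ζ * (conj (tau n α τ ζ k) - conj (α k)) := by
  have h := tau_of_lt n α τ ζ k hk
  rw [eq_div_iff (conj_mul_add_ne_zero (hα k hk) (norm_tau hα hτ hζ _) hζ)] at h
  have h2 := congrArg conj h
  simp only [map_mul, map_add, Complex.conj_conj] at h2
  rw [gap]
  linear_combination -h2

theorem conj_tau_mul_conj_gap (hα : ∀ j < n, ‖α j‖ < 1) (hτ : ‖τ‖ = 1) (hζ : ‖ζ‖ = 1) (k : ℕ) :
    conj (tau n α τ ζ k) * conj (gap n α τ ζ k) = conj (tau n α τ ζ k) - conj (α k) := by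
  simp only [gap, map_sub, map_one, map_mul, Complex.conj_conj]
  linear_combination (-conj (α k)) * tau_mul_conj hα hτ hζ k

theorem gap_add_conj (hα : ∀ j < n, ‖α j‖ < 1) (hτ : ‖τ‖ = 1) (hζ : ‖ζ‖ = 1) {k : ℕ} (hk : k < n) :
    gap n α τ ζ k + conj (gap n α τ ζ k) =
      (rho (α k) : ℂ) ^ 2 + gap n α τ ζ k * conj (gap n α τ ζ k) := by
  simp only [gap, map_sub, map_one, map_mul, Complex.conj_conj]
  linear_combination (-α k * conj (α k)) * tau_mul_conj hα hτ hζ k - rho_sq (hα k hk)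

theorem add_conj_tau_mul (hα : ∀ j < n, ‖α j‖ < 1) (hτ : ‖τ‖ = 1) (hζ : ‖ζ‖ = 1) {k : ℕ}
    (hk : k < n) : (ζ + conj (tau n α τ ζ (k + 1)) * α k) * gap n α τ ζ k =
      ζ * (rho (α k) : ℂ) ^ 2 := by
  have h := conj_tau_succ_mul_gap hα hτ hζ hk
  rw [rho_sq (hα k hk)]
  have : gap n α τ ζ k = 1 - conj (tau n α τ ζ k) * α k := rfl
  linear_combination α k * h + ζ * this

/-- One step for the paraorthogonal values with the coefficients `τ_k(ζ)`. -/
theorem gap_mul_paraVal_succ (hα : ∀ j < n, ‖α j‖ < 1) (hτ : ‖τ‖ = 1) (hζ : ‖ζ‖ = 1) (z : ℂ)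
    {k : ℕ} (hk : k < n) : gap n α τ ζ k * paraVal α (tau n α τ ζ (k + 1)) z (k + 1) =
      (gap n α τ ζ k * (z - ζ) + ζ * (rho (α k) : ℂ) ^ 2) * paraVal α (tau n α τ ζ k) z k +
        gap n α τ ζ k * (z - ζ) * (conj (tau n α τ ζ k) - conj (α k)) * (szego α z k).2 := by
  have h := conj_tau_succ_mul_gap hα hτ hζ hk
  rw [rho_sq (hα k hk)]
  simp only [paraVal, szego]
  have h2 : gap n α τ ζ k = 1 - conj (tau n α τ ζ k) * α k := rfl
  linear_combination (-((szego α z k).2 - α k * (szego α z k).1)) * h +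
    ζ * ((szego α z k).1 - conj (α k) * (szego α z k).2) * h2

/-- At `z = ζ` the inhomogeneous term of `gap_mul_paraVal_succ` drops out, so a zero at index `0`
propagates to index `n`. This is why the denominator of `β_0` can vanish only if `ζ` is an
eigenvalue. -/
theorem paraVal_self_eq_zero (hα : ∀ j < n, ‖α j‖ < 1) (hτ : ‖τ‖ = 1) (hζ : ‖ζ‖ = 1)
    (h0 : ζ = conj (tau n α τ ζ 0)) : paraVal α τ ζ n = 0 := by
  have key : ∀ k ≤ n, paraVal α (tau n α τ ζ k) ζ k = 0 := by
    intro k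
    induction k with
    | zero => intro _; simpa [paraVal, szego, sub_eq_zero] using h0
    | succ k ih =>
      intro hk
      have h := gap_mul_paraVal_succ hα hτ hζ ζ (k := k) (by omega)
      rw [ih (by omega)] at h
      simpa [gap_ne_zero hα hτ hζ (k := k) (by omega)] using h
  simpa [tau_last] using key n le_rfl

/-- Two consecutive one-step relations both contain `Φ_k^*`, once `Φ_{k+1}^*` is rewritten through
it; eliminating it leaves a three-term recursion. -/
theorem gap_mul_paraVal_succ_succ (hα : ∀ j < n, ‖α j‖ < 1) (hτ : ‖τ‖ = 1) (hζ : ‖ζ‖ = 1) (z : ℂ)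
    {k : ℕ} (hk : k + 1 < n) :
    gap n α τ ζ k * gap n α τ ζ (k + 1) * paraVal α (tau n α τ ζ (k + 2)) z (k + 2) =
      gap n α τ ζ k * (gap n α τ ζ (k + 1) * z + ζ * conj (gap n α τ ζ (k + 1))) *
          paraVal α (tau n α τ ζ (k + 1)) z (k + 1) -
        ζ * z * (rho (α k) : ℂ) ^ 2 * conj (gap n α τ ζ (k + 1)) * gap n α τ ζ (k + 1) *
          paraVal α (tau n α τ ζ k) z k := by
  have hk' : k < n := by omega
  have h1 := gap_mul_paraVal_succ hα hτ hζ z hk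
  have h2 := gap_mul_paraVal_succ hα hτ hζ z hk'
  have h3 := conj_tau_succ_mul_gap hα hτ hζ hk'
  have h4 := conj_tau_mul_conj_gap hα hτ hζ (k + 1)
  have h5 := gap_add_conj hα hτ hζ hk
  have h6 : gap n α τ ζ k = 1 - conj (tau n α τ ζ k) * α k := rfl
  have h7 := rho_sq (hα k hk')
  have h9 : (szego α z (k + 1)).2 = gap n α τ ζ k * (szego α z k).2 -
      α k * paraVal α (tau n α τ ζ k) z k := by
    rw [h6]; simp only [szego, paraVal]; ring
  rw [h9] at h1
  rw [← h4] at h1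
  have hg := gap_ne_zero hα hτ hζ hk'
  set g := gap n α τ ζ k
  set g' := gap n α τ ζ (k + 1)
  set W := paraVal α (tau n α τ ζ k) z k
  set W' := paraVal α (tau n α τ ζ (k + 1)) z (k + 1)
  set W'' := paraVal α (tau n α τ ζ (k + 2)) z (k + 2)
  set S := (szego α z k).2
  set t := conj (tau n α τ ζ k)
  set t' := conj (tau n α τ ζ (k + 1))
  have h10 : t' * α k * g = ζ * ((rho (α k) : ℂ) ^ 2 - g) := by
    linear_combination α k * h3 - ζ * h7 + ζ * h6
  apply mul_left_cancel₀ hg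
  linear_combination g ^ 2 * h1 - g * ζ * g' * conj g' * h2 + g ^ 2 * ζ * W' * (-h5) +
    g ^ 2 * g' * conj g' * (z - ζ) * S * h3 - g * g' * conj g' * (z - ζ) * W * h10

end Coefficients

/-! ### Closed forms for `β_k` and `p_k` -/

section Pencil

variable {n : ℕ} {α : ℕ → ℂ} {τ ζ s : ℂ}

variable (n α τ ζ) in
/-- The positive numbers `c_k` with `β_{k+1} = s c_k / (1 - conj τ_k α_k)`. -/
noncomputable def scale : ℕ → ℝ
  | 0 => 1
  | k + 1 => ‖gap n α τ ζ k‖ ^ 2 / (scale k * rho (α k) ^ 2)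

theorem scale_pos (hα : ∀ j < n, ‖α j‖ < 1) (hτ : ‖τ‖ = 1) (hζ : ‖ζ‖ = 1) {k : ℕ} (hk : k ≤ n) :
    0 < scale n α τ ζ k := by
  induction k with
  | zero => simp [scale]
  | succ k ih =>
    have h1 := norm_pos_iff.2 (gap_ne_zero hα hτ hζ (k := k) (by omega))
    have h2 := rho_pos (hα k (by omega))
    have h3 := ih (by omega)
    rw [scale]
    positivity

theorem scale_mul_scale (hα : ∀ j < n, ‖α j‖ < 1) (hτ : ‖τ‖ = 1) (hζ : ‖ζ‖ = 1) {k : ℕ}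
    (hk : k < n) : (scale n α τ ζ k : ℂ) * scale n α τ ζ (k + 1) * (rho (α k) : ℂ) ^ 2 =
      gap n α τ ζ k * conj (gap n α τ ζ k) := by
  have h2 := (rho_pos (hα k hk)).ne'
  have h3 := (scale_pos hα hτ hζ hk.le).ne'
  rw [Complex.mul_conj, Complex.normSq_eq_norm_sq, scale]
  norm_cast
  field_simp

theorem norm_sqrt (hζ : ‖ζ‖ = 1) (hs : s ^ 2 = ζ) : ‖s‖ = 1 := by
  rw [← hs, norm_pow] at hζ
  exact (pow_eq_one_iff_of_nonneg (norm_nonneg s) two_ne_zero).1 hζ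

theorem conj_sub_tau_mul (hζ : ‖ζ‖ = 1) (hs : s ^ 2 = ζ) (t : ℂ) :
    conj s - t * s = s * (conj ζ - t) := by
  rw [← hs, map_pow]
  linear_combination (-conj s) * mul_conj_eq_one (norm_sqrt hζ hs)

theorem beta_denominator_ne_zero (hα : ∀ j < n, ‖α j‖ < 1) (hτ : ‖τ‖ = 1) (hζ : ‖ζ‖ = 1)
    (hS : ζ ∉ spectrum ℂ (matG n α τ)) : conj ζ - tau n α τ ζ 0 ≠ 0 := by
  intro h
  refine hS ((mem_spectrum_matG_iff hα (norm_ne_zero_iff.1 (by rw [hζ]; simp))).2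
    (paraVal_self_eq_zero hα hτ hζ ?_))
  rw [← sub_eq_zero.1 h, Complex.conj_conj]

theorem beta_zero (hζ : ‖ζ‖ = 1) (hs : s ^ 2 = ζ) :
    beta n α τ ζ s 0 = 1 / (s * (conj ζ - tau n α τ ζ 0)) := by
  rw [beta, conj_sub_tau_mul hζ hs]

/-- By `add_conj_tau_mul` the factor `conj ζ + τ_k conj α_{k-1}` equals `conj ζ ρ² / conj gap` at
index `k - 1`. In the product with `1 / β_k` only `|gap|²` and `ρ²` survive, besides powers of `s`,
and `scale` collects these. -/
theorem beta_succ (hα : ∀ j < n, ‖α j‖ < 1) (hτ : ‖τ‖ = 1) (hζ : ‖ζ‖ = 1) (hs : s ^ 2 = ζ)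
    (h0 : conj ζ - tau n α τ ζ 0 ≠ 0) {k : ℕ} (hk : k < n) :
    beta n α τ ζ s (k + 1) = s * scale n α τ ζ k / gap n α τ ζ k := by
  have hs1 := norm_sqrt hζ hs
  have hs0 : s ≠ 0 := norm_ne_zero_iff.1 (by rw [hs1]; simp)
  induction k with
  | zero =>
    have hg : 1 - conj (tau n α τ ζ 0) * α 0 ≠ 0 := gap_ne_zero hα hτ hζ hk
    rw [beta, beta_zero hζ hs]
    have h1 : conj ζ + tau n α τ ζ 0 * conj (if 0 = 0 then -1 else α (0 - 1)) =
      conj ζ - tau n α τ ζ 0 := by simp; ring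
    rw [h1, scale, gap]
    field_simp
    push_cast
    ring
  | succ k ih =>
    have hg := gap_ne_zero hα hτ hζ hk
    have hg' := gap_ne_zero hα hτ hζ (k := k) (by omega)
    have hgc : conj (gap n α τ ζ k) ≠ 0 := (map_ne_zero _).2 hg'
    have hr := rho_ne_zero (hα k (by omega))
    have hc := Complex.ofReal_ne_zero.2 (scale_pos hα hτ hζ (k := k) (by omega)).ne'
    have hm := scale_mul_scale hα hτ hζ (k := k) (by omega)
    have hζc : conj ζ ≠ 0 := (map_ne_zero _).2 (norm_ne_zero_iff.1 (by rw [hζ]; simp))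
    rw [beta, ih (by omega)]
    have h1 := congrArg conj (add_conj_tau_mul hα hτ hζ (k := k) (by omega))
    simp only [map_mul, map_add, map_pow, Complex.conj_conj, Complex.conj_ofReal] at h1
    have h2 : conj ζ + tau n α τ ζ (k + 1) * conj (if k + 1 = 0 then -1 else α (k + 1 - 1)) =
        conj ζ * (rho (α k) : ℂ) ^ 2 / conj (gap n α τ ζ k) := by
      rw [eq_div_iff hgc, ← h1]; simp
    have h3 : 1 - conj (tau n α τ ζ (k + 1)) * α (k + 1) = gap n α τ ζ (k + 1) := rfl
    have h4 : s ^ 2 * conj ζ = 1 := by rw [hs]; exact mul_conj_eq_one hζ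
    rw [h2, h3]
    field_simp
    rw [← hm]
    linear_combination (-scale n α τ ζ k * scale n α τ ζ (k + 1) * (rho (α k) : ℂ) ^ 2) * h4

theorem beta_ne_zero (hα : ∀ j < n, ‖α j‖ < 1) (hτ : ‖τ‖ = 1) (hζ : ‖ζ‖ = 1) (hs : s ^ 2 = ζ)
    (h0 : conj ζ - tau n α τ ζ 0 ≠ 0) {k : ℕ} (hk : k ≤ n) : beta n α τ ζ s k ≠ 0 := by
  have hs0 : s ≠ 0 := norm_ne_zero_iff.1 (by rw [norm_sqrt hζ hs]; simp)
  cases k with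
  | zero => rw [beta_zero hζ hs]; exact one_div_ne_zero (mul_ne_zero hs0 h0)
  | succ k =>
    rw [beta_succ hα hτ hζ hs h0 (by omega)]
    exact div_ne_zero (mul_ne_zero hs0 (Complex.ofReal_ne_zero.2
      (scale_pos hα hτ hζ (by omega)).ne')) (gap_ne_zero hα hτ hζ (by omega))

/-- After multiplication by the product of the `conj β_j`, the recursion `gap_mul_paraVal_succ_succ`
is the one defining `p_k`. Matching coefficients needs the phase of `β_k` (`hb0'`, `hbs`) and the
product of two consecutive ones (`hbb`). -/
theorem pVal_succ (hα : ∀ j < n, ‖α j‖ < 1) (hτ : ‖τ‖ = 1) (hζ : ‖ζ‖ = 1) (hs : s ^ 2 = ζ)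
    (h0 : conj ζ - tau n α τ ζ 0 ≠ 0) (p₀ : ℝ) (z : ℂ) {k : ℕ} (hk : k ≤ n) :
    pVal (beta n α τ ζ s) p₀ z (k + 1) =
      p₀ * (∏ j ∈ Finset.range (k + 1), conj (beta n α τ ζ s j)) *
        paraVal α (tau n α τ ζ k) z k := by
  have hs1 := mul_conj_eq_one (norm_sqrt hζ hs)
  have hs0 : s ≠ 0 := left_ne_zero_of_mul_eq_one hs1
  have hsc : conj s ≠ 0 := right_ne_zero_of_mul_eq_one hs1
  have h0c : ζ - conj (tau n α τ ζ 0) ≠ 0 := by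
    have := (map_ne_zero (starRingEnd ℂ)).2 h0
    simpa using this
  have ht := tau_mul_conj hα hτ hζ (k := 0)
  have hb0 : conj (beta n α τ ζ s 0) * (ζ - conj (tau n α τ ζ 0)) = s := by
    rw [beta_zero hζ hs]
    simp only [map_div₀, map_one, map_mul, map_sub, Complex.conj_conj]
    field_simp
    linear_combination -hs1
  have hb0' : beta n α τ ζ s 0 = -conj (tau n α τ ζ 0) * conj (beta n α τ ζ s 0) := by
    apply mul_right_cancel₀ h0c
    rw [mul_assoc, hb0, beta_zero hζ hs]
    field_simp
    linear_combination conj (tau n α τ ζ 0) * mul_conj_eq_one hζ - ζ * ht +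
      conj (tau n α τ ζ 0) * (conj ζ - tau n α τ ζ 0) * hs
  have hbs : ∀ k < n, beta n α τ ζ s (k + 1) * gap n α τ ζ k =
      ζ * conj (gap n α τ ζ k) * conj (beta n α τ ζ s (k + 1)) := by
    intro k hk
    have hg := gap_ne_zero hα hτ hζ hk
    have hgc : conj (gap n α τ ζ k) ≠ 0 := (map_ne_zero _).2 hg
    rw [beta_succ hα hτ hζ hs h0 hk]
    simp only [map_div₀, map_mul, Complex.conj_ofReal]
    field_simp
    linear_combination (scale n α τ ζ k : ℂ) * (-s * hs1 + conj s * hs)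
  induction k using Nat.twoStepInduction with
  | zero =>
    rw [pVal, zero_add, Finset.prod_range_one]
    simp only [paraVal, szego]
    linear_combination (p₀ : ℂ) * hb0'
  -- The recursion for `p_2` involves the constant `p_0`, which the formula does not cover, so this
  -- case is computed by hand.
  | one =>
    have hg := gap_ne_zero hα hτ hζ (k := 0) (by omega)
    have h1 := gap_mul_paraVal_succ hα hτ hζ z (k := 0) (by omega)
    have h2 := hbs 0 (by omega)
    have h3 := gap_add_conj hα hτ hζ (k := 0) (by omega)
    have h4 := conj_tau_mul_conj_gap hα hτ hζ 0
    have hbg : conj (beta n α τ ζ s 1) * conj (gap n α τ ζ 0) = conj s := by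
      have hgc : conj (gap n α τ ζ 0) ≠ 0 := (map_ne_zero _).2 hg
      rw [beta_succ hα hτ hζ hs h0 (by omega), scale]
      simp only [map_div₀, map_mul, Complex.conj_ofReal]
      field_simp
      simp
    rw [pVal, pVal, pVal, Finset.prod_range_succ, Finset.prod_range_one]
    rw [← h4] at h1
    simp only [paraVal, zero_add] at h1 h2 ⊢
    have e0 : szego α z 0 = (z, 1) := rfl
    rw [e0] at h1
    generalize (szego α z 1).1 - conj (tau n α τ ζ 1) * (szego α z 1).2 = W at h1 ⊢
    generalize beta n α τ ζ s 1 = b1 at *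
    generalize conj b1 = b1' at *
    generalize beta n α τ ζ s 0 = b0 at *
    generalize conj b0 = b0' at *
    generalize gap n α τ ζ 0 = g at *
    generalize conj g = g' at *
    generalize conj (tau n α τ ζ 0) = t at *
    apply mul_left_cancel₀ hg
    subst hb0'
    simp only at h1
    linear_combination (-p₀ * b1' * b0') * h1 + p₀ * b0' * (z - t) * h2 -
      p₀ * b0' * b1' * ζ * (z - t) * (-h3) + p₀ * g * z * (ζ - t) * b0' * hbg +
      p₀ * g * z * conj s * hb0 + p₀ * g * z * hs1
  | more k ih1 ih2 =>
    have hg := gap_ne_zero hα hτ hζ (k := k) (by omega)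
    have hg' := gap_ne_zero hα hτ hζ (k := k + 1) (by omega)
    have h1 := gap_mul_paraVal_succ_succ hα hτ hζ z (k := k) (by omega)
    have h2 := hbs (k + 1) (by omega)
    have hbb : conj (beta n α τ ζ s (k + 2)) * conj (beta n α τ ζ s (k + 1)) * ζ *
        (rho (α k) : ℂ) ^ 2 * conj (gap n α τ ζ (k + 1)) = gap n α τ ζ k := by
      have hgc : conj (gap n α τ ζ k) ≠ 0 := (map_ne_zero _).2 hg
      have hgc' : conj (gap n α τ ζ (k + 1)) ≠ 0 := (map_ne_zero _).2 hg'
      rw [beta_succ hα hτ hζ hs h0 (by omega), beta_succ hα hτ hζ hs h0 (by omega)]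
      simp only [map_div₀, map_mul, Complex.conj_ofReal]
      field_simp
      have := scale_mul_scale hα hτ hζ (k := k) (by omega)
      linear_combination this + (scale n α τ ζ k * scale n α τ ζ (k + 1) * (rho (α k) : ℂ) ^ 2) *
        ((s * conj s + 1) * hs1 - conj s ^ 2 * hs)
    rw [pVal, ih2 (by omega), ih1 (by omega), Finset.prod_range_succ _ (k + 2),
      Finset.prod_range_succ _ (k + 1)]
    generalize (∏ j ∈ Finset.range (k + 1), conj (beta n α τ ζ s j)) = P
    generalize paraVal α (tau n α τ ζ (k + 2)) z (k + 2) = W'' at *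
    generalize paraVal α (tau n α τ ζ (k + 1)) z (k + 1) = W' at *
    generalize paraVal α (tau n α τ ζ k) z k = W at *
    apply mul_left_cancel₀ (mul_ne_zero hg hg')
    linear_combination (-p₀ * P * conj (beta n α τ ζ s (k + 1)) * conj (beta n α τ ζ s (k + 2))) * h1 +
      p₀ * P * conj (beta n α τ ζ s (k + 1)) * gap n α τ ζ k * W' * h2 +
      p₀ * P * z * gap n α τ ζ (k + 1) * W * hbb

end Pencil

/-! ### Bidiagonal matrices: positivity of `H` and the pencil `K - λ H` -/

theorem sum_lower_bidiagonal {n : ℕ} (i : Fin (n + 1)) (b c : ℂ) (f : ℕ → ℂ) :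
    ∑ x : Fin (n + 1), (if i = x then b else if (i : ℕ) = x + 1 then c else 0) * f x =
      b * f i + if (i : ℕ) = 0 then 0 else c * f (i - 1) := by
  have h1 : ∀ x : Fin (n + 1), (if i = x then b else if (i : ℕ) = x + 1 then c else 0) * f x =
      (fun y : ℕ => (if y = (i : ℕ) then b * f y else 0) +
        if (i : ℕ) = y + 1 then c * f y else 0) x := by
    intro x
    simp only [Fin.ext_iff]
    split_ifs <;> first | omega | simp
  rw [Finset.sum_congr rfl fun x _ => h1 x, Fin.sum_univ_eq_sum_range (fun y : ℕ =>
    (if y = (i : ℕ) then b * f y else 0) + if (i : ℕ) = y + 1 then c * f y else 0),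
    Finset.sum_add_distrib, Finset.sum_ite_eq', if_pos (by simp; omega)]
  congr 1
  by_cases hi : (i : ℕ) = 0
  · simp [hi]
  · rw [if_neg hi, Finset.sum_eq_single ((i : ℕ) - 1)]
    · rw [if_pos (by omega)]
    · intro y _ hy; rw [if_neg (by omega)]
    · intro hy; exact absurd (Finset.mem_range.2 (by omega)) hy

/-- The hypothesis `hf` supplies the neighbour missing in the last row; it is applied with
`p_{n+1}(z) = 0`. -/
theorem sum_upper_bidiagonal {n : ℕ} (i : Fin (n + 1)) (b c : ℂ) {f : ℕ → ℂ} (hf : f (n + 1) = 0) :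
    ∑ x : Fin (n + 1), (if i = x then b else if (x : ℕ) = i + 1 then c else 0) * f x =
      b * f i + c * f (i + 1) := by
  have h1 : ∀ x : Fin (n + 1), (if i = x then b else if (x : ℕ) = i + 1 then c else 0) * f x =
      (fun y : ℕ => (if y = (i : ℕ) then b * f y else 0) +
        if y = (i : ℕ) + 1 then c * f y else 0) x := by
    intro x
    simp only [Fin.ext_iff]
    split_ifs <;> first | omega | simp
  rw [Finset.sum_congr rfl fun x _ => h1 x, Fin.sum_univ_eq_sum_range (fun y : ℕ =>
    (if y = (i : ℕ) then b * f y else 0) + if y = (i : ℕ) + 1 then c * f y else 0),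
    Finset.sum_add_distrib, Finset.sum_ite_eq', Finset.sum_ite_eq', if_pos (by simp; omega)]
  congr 1
  split_ifs with h
  · rfl
  · rw [show (i : ℕ) + 1 = n + 1 by simp at h; omega, hf, mul_zero]

section

variable {n : ℕ} {α : ℕ → ℂ} {τ ζ s : ℂ}

variable (n α τ ζ s) in
/-- The upper bidiagonal factor `D` in the factorization `H = Dᴴ D`. -/
noncomputable def cholesky : Matrix (Fin (n + 1)) (Fin (n + 1)) ℂ :=
  Matrix.of fun i k =>
    if i = k then (Real.sqrt (1 / (2 * scale n α τ ζ i)) : ℂ)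
    else if (k : ℕ) = i + 1 then
      -conj s * scale n α τ ζ i * (Real.sqrt (1 / (2 * scale n α τ ζ i)) : ℂ)
    else 0

theorem sq_sqrt_inv_scale {c : ℝ} (hc : 0 < c) :
    (Real.sqrt (1 / (2 * c)) : ℂ) * (Real.sqrt (1 / (2 * c)) : ℂ) * c = 1 / 2 := by
  norm_cast
  rw [Real.mul_self_sqrt (by positivity)]
  push_cast
  have : (c : ℂ) ≠ 0 := Complex.ofReal_ne_zero.2 hc.ne'
  field_simp

theorem re_beta_zero (hα : ∀ j < n, ‖α j‖ < 1) (hτ : ‖τ‖ = 1) (hζ : ‖ζ‖ = 1) (hs : s ^ 2 = ζ)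
    (h0 : conj ζ - tau n α τ ζ 0 ≠ 0) :
    s * conj (beta n α τ ζ s 0) + conj s * beta n α τ ζ s 0 = 1 := by
  have hs1 := mul_conj_eq_one (norm_sqrt hζ hs)
  have hs0 : s ≠ 0 := left_ne_zero_of_mul_eq_one hs1
  have hsc : conj s ≠ 0 := right_ne_zero_of_mul_eq_one hs1
  have h0c : ζ - conj (tau n α τ ζ 0) ≠ 0 := by
    have := (map_ne_zero (starRingEnd ℂ)).2 h0
    simpa using this
  have ht := tau_mul_conj hα hτ hζ 0
  have hζ1 := mul_conj_eq_one hζ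
  have hsζ : s = ζ * conj s := by rw [← hs]; linear_combination -s * hs1
  have hsζ' : conj s = conj ζ * s := by rw [← hs, map_pow]; linear_combination -conj s * hs1
  rw [beta_zero hζ hs]
  simp only [map_div₀, map_one, map_mul, map_sub, Complex.conj_conj]
  have e1 : s * (1 / (conj s * (ζ - conj (tau n α τ ζ 0)))) = ζ / (ζ - conj (tau n α τ ζ 0)) := by
    field_simp
    linear_combination hsζ
  have e2 : conj s * (1 / (s * (conj ζ - tau n α τ ζ 0))) = conj ζ / (conj ζ - tau n α τ ζ 0) := by
    field_simp
    linear_combination hsζ'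
  rw [e1, e2]
  field_simp
  linear_combination hζ1 - ht

/-- Divide `gap_add_conj` by `|gap|²` and use `scale_mul_scale`. The right side is twice the
diagonal entry of `Dᴴ D` at `k + 1`. -/
theorem re_beta_succ (hα : ∀ j < n, ‖α j‖ < 1) (hτ : ‖τ‖ = 1) (hζ : ‖ζ‖ = 1) (hs : s ^ 2 = ζ)
    (h0 : conj ζ - tau n α τ ζ 0 ≠ 0) {k : ℕ} (hk : k < n) :
    s * conj (beta n α τ ζ s (k + 1)) + conj s * beta n α τ ζ s (k + 1) =
      1 / scale n α τ ζ (k + 1) + scale n α τ ζ k := by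
  have hs1 := mul_conj_eq_one (norm_sqrt hζ hs)
  have hg := gap_ne_zero hα hτ hζ hk
  have hgc : conj (gap n α τ ζ k) ≠ 0 := (map_ne_zero _).2 hg
  have h1 := gap_add_conj hα hτ hζ hk
  have h2 := scale_mul_scale hα hτ hζ hk
  have hc : (scale n α τ ζ (k + 1) : ℂ) ≠ 0 :=
    Complex.ofReal_ne_zero.2 (scale_pos hα hτ hζ hk).ne'
  rw [beta_succ hα hτ hζ hs h0 hk]
  simp only [map_div₀, map_mul, Complex.conj_ofReal]
  have e1 : s * (conj s * scale n α τ ζ k / conj (gap n α τ ζ k)) +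
      conj s * (s * scale n α τ ζ k / gap n α τ ζ k) =
        s * conj s * (scale n α τ ζ k * (gap n α τ ζ k + conj (gap n α τ ζ k)) /
          (gap n α τ ζ k * conj (gap n α τ ζ k))) := by
    field_simp
  rw [e1, hs1, h1]
  field_simp
  linear_combination h2

theorem matH_eq (hα : ∀ j < n, ‖α j‖ < 1) (hτ : ‖τ‖ = 1) (hζ : ‖ζ‖ = 1) (hs : s ^ 2 = ζ)
    (h0 : conj ζ - tau n α τ ζ 0 ≠ 0) :
    matH n α τ ζ s = (cholesky n α τ ζ s)ᴴ * cholesky n α τ ζ s := by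
  have hs1 := mul_conj_eq_one (norm_sqrt hζ hs)
  set r : ℕ → ℂ := fun y => (Real.sqrt (1 / (2 * scale n α τ ζ y)) : ℂ)
  set c : ℕ → ℂ := fun y => (scale n α τ ζ y : ℂ)
  have hrc : ∀ y ≤ n, r y * r y * c y = 1 / 2 := fun y hy =>
    sq_sqrt_inv_scale (scale_pos hα hτ hζ hy)
  ext i k
  have hD : ∀ x : Fin (n + 1), cholesky n α τ ζ s x k = (fun y : ℕ =>
      if y = (k : ℕ) then r y else if (k : ℕ) = y + 1 then -conj s * c y * r y else 0) x := by
    intro x; simp [cholesky, Fin.ext_iff, r, c]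
  have hDH : ∀ x : Fin (n + 1), (cholesky n α τ ζ s)ᴴ i x =
      if i = x then r i else if (i : ℕ) = x + 1 then -s * c (i - 1) * r (i - 1) else 0 := by
    intro x
    rw [Matrix.conjTranspose_apply]
    by_cases h1 : i = x
    · subst h1; simp [cholesky, r]
    · by_cases h2 : (i : ℕ) = x + 1
      · simp [cholesky, h1, Ne.symm h1, h2, r, c]
      · simp [cholesky, h1, Ne.symm h1, h2]
  have hsum : ((cholesky n α τ ζ s)ᴴ * cholesky n α τ ζ s) i k = _ :=
    (Finset.sum_congr rfl fun x _ => congrArg₂ (· * ·) (hDH x) (hD x)).trans (sum_lower_bidiagonal i (r i)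
      (-s * c (i - 1) * r (i - 1)) (fun y : ℕ =>
        if y = (k : ℕ) then r y else if (k : ℕ) = y + 1 then -conj s * c y * r y else 0))
  rw [hsum]
  simp only [matH, matA, Matrix.smul_apply, Matrix.add_apply, Matrix.conjTranspose_apply,
    Matrix.of_apply, smul_eq_mul, star_mul', Fin.ext_iff]
  have hi := hrc i (by omega)
  by_cases e1 : (i : ℕ) = k
  · rw [← e1]
    simp only [if_true, RCLike.star_def, Complex.conj_conj]
    by_cases e2 : (i : ℕ) = 0
    · have hb := re_beta_zero hα hτ hζ hs h0
      have hc0 : c 0 = 1 := by simp [c, scale]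
      rw [e2, hc0] at hi
      rw [e2]
      simp only [if_true]
      linear_combination (1 / 2) * hb - hi
    · obtain ⟨l, hl⟩ : ∃ l, (i : ℕ) = l + 1 := ⟨i - 1, by omega⟩
      have hb := re_beta_succ hα hτ hζ hs h0 (k := l) (by omega)
      change _ = 1 / c (l + 1) + c l at hb
      have hl' := hrc l (by omega)
      have hci : c (l + 1) ≠ 0 :=
        Complex.ofReal_ne_zero.2 (scale_pos hα hτ hζ (k := l + 1) (by omega)).ne'
      rw [hl] at hi
      have hi' : r (l + 1) * r (l + 1) = (1 / 2) * (1 / c (l + 1)) := by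
        field_simp
        linear_combination 2 * hi
      rw [hl]
      simp only [Nat.succ_ne_zero, if_false, Nat.add_sub_cancel, (Nat.succ_ne_self l).symm, if_true]
      linear_combination (1 / 2) * hb - hi' - c l * hl' - r l * c l * c l * r l * hs1
  · have e1' : (k : ℕ) ≠ i := Ne.symm e1
    by_cases e2 : (i : ℕ) = k + 1
    · have e3 : (k : ℕ) ≠ k + 1 + 1 := by omega
      have hk := hrc k (by omega)
      simp [e2, e3]
      linear_combination -s * hk
    by_cases e3 : (k : ℕ) = i + 1
    · have e4 : (i : ℕ) ≠ i + 1 + 1 := by omega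
      simp only [e3, e4, if_true, if_false, Nat.succ_ne_self, (Nat.succ_ne_self _).symm]
      by_cases e5 : (i : ℕ) = 0
      · simp [e5] at hi ⊢
        linear_combination -conj s * hi
      · have e6 : (i : ℕ) - 1 ≠ i + 1 := by omega
        have e7 : (i : ℕ) ≠ i - 1 := by omega
        simp [e5, e6, e7]
        linear_combination -conj s * hi
    · have e4 : (i : ℕ) - 1 = k → (i : ℕ) = 0 := by omega
      have e5 : (k : ℕ) = i - 1 + 1 → (i : ℕ) = 0 := by omega
      by_cases e6 : (i : ℕ) = 0
      · rw [e6] at e1 e3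
        simp [e1, Ne.symm e1, e3, e6]
      · simp [e1, e1', e2, e3, e6, mt e4 e6, mt e5 e6]

theorem posDef_matH (hα : ∀ j < n, ‖α j‖ < 1) (hτ : ‖τ‖ = 1) (hζ : ‖ζ‖ = 1) (hs : s ^ 2 = ζ)
    (h0 : conj ζ - tau n α τ ζ 0 ≠ 0) : (matH n α τ ζ s).PosDef := by
  rw [matH_eq hα hτ hζ hs h0]
  refine Matrix.PosDef.conjTranspose_mul_self _ (Matrix.mulVec_injective_of_isUnit ?_)
  rw [Matrix.isUnit_iff_isUnit_det, isUnit_iff_ne_zero, Matrix.det_of_isUpperTriangular]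
  · refine Finset.prod_ne_zero_iff.2 fun i _ => ?_
    have := scale_pos hα hτ hζ (k := i) (by omega)
    simp only [cholesky, Matrix.of_apply, if_true]
    exact Complex.ofReal_ne_zero.2 (Real.sqrt_pos.2 (by positivity)).ne'
  · intro i k hik
    have hik : k < i := hik
    have h1 : i ≠ k := hik.ne'
    have h2 : (k : ℕ) ≠ i + 1 := by omega
    simp [cholesky, h1, h2]

/-- Row `i` is the recursion in the form `β_i p_i - p_{i+1} = -z (conj β_i p_i - p_{i-1})`; the
factor `conj ζ` is `conj s / s`. -/
theorem conjTranspose_matA_mulVec (hζ : ‖ζ‖ = 1) (hs : s ^ 2 = ζ)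
    {p₀ : ℝ} {z : ℂ} (hz : pVal (beta n α τ ζ s) p₀ z (n + 1) = 0) :
    (matA n α τ ζ s)ᴴ *ᵥ pVec n α τ ζ s p₀ z =
      (-(z * conj ζ)) • (matA n α τ ζ s *ᵥ pVec n α τ ζ s p₀ z) := by
  have hs1 := mul_conj_eq_one (norm_sqrt hζ hs)
  have hζs : conj ζ = conj s ^ 2 := by rw [← hs, map_pow]
  set f := pVal (beta n α τ ζ s) p₀ z with hf
  have hA : ∀ i : Fin (n + 1), (matA n α τ ζ s *ᵥ pVec n α τ ζ s p₀ z) i =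
      s * (conj (beta n α τ ζ s i) * f i + if (i : ℕ) = 0 then 0 else -1 * f (i - 1)) := by
    intro i
    rw [matA, Matrix.smul_mulVec, Pi.smul_apply, smul_eq_mul, ← sum_lower_bidiagonal]
    rfl
  have hAH : ∀ i : Fin (n + 1), ((matA n α τ ζ s)ᴴ *ᵥ pVec n α τ ζ s p₀ z) i =
      conj s * (beta n α τ ζ s i * f i + -1 * f (i + 1)) := by
    intro i
    rw [matA, Matrix.conjTranspose_smul, Matrix.smul_mulVec, Pi.smul_apply, smul_eq_mul,
      ← sum_upper_bidiagonal i (beta n α τ ζ s i) (-1) hz]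
    simp only [Matrix.mulVec, dotProduct]
    congr 1
    refine Finset.sum_congr rfl fun x _ => ?_
    congr 1
    rw [Matrix.conjTranspose_apply, Matrix.of_apply]
    by_cases h : i = x
    · subst h; simp
    · by_cases h2 : (x : ℕ) = i + 1 <;> simp [h, Ne.symm h, h2]
  funext i
  rw [hAH, Pi.smul_apply, smul_eq_mul, hA, hζs]
  by_cases hi : (i : ℕ) = 0
  · simp only [hi, if_true, zero_add, hf, pVal]
    linear_combination z * conj s * conj (beta n α τ ζ s 0) * p₀ * hs1
  · obtain ⟨l, hl⟩ : ∃ l, (i : ℕ) = l + 1 := ⟨i - 1, by omega⟩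
    simp only [hl, Nat.succ_ne_zero, if_false, Nat.add_sub_cancel, hf, pVal]
    linear_combination z * conj s * (conj (beta n α τ ζ s (l + 1)) *
      pVal (beta n α τ ζ s) p₀ z (l + 1) - pVal (beta n α τ ζ s) p₀ z l) * hs1

/-- Both sides are multiples of `A p`: `K p = (1 + z ζ̄)/(2i) A p` and `H p = (1 - z ζ̄)/2 A p`. -/
theorem matK_mulVec_pVec (hζ : ‖ζ‖ = 1) (hs : s ^ 2 = ζ)
    {p₀ : ℝ} {z : ℂ} (hz : pVal (beta n α τ ζ s) p₀ z (n + 1) = 0) (hzζ : z ≠ ζ) :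
    matK n α τ ζ s *ᵥ pVec n α τ ζ s p₀ z =
      (Complex.I * (z + ζ) / (z - ζ)) • (matH n α τ ζ s *ᵥ pVec n α τ ζ s p₀ z) := by
  have hζ1 := mul_conj_eq_one hζ
  rw [matK, matH, Matrix.smul_mulVec, Matrix.smul_mulVec, Matrix.sub_mulVec, Matrix.add_mulVec,
    conjTranspose_matA_mulVec hζ hs hz]
  have hne := sub_ne_zero.2 hzζ
  funext i
  simp only [Pi.smul_apply, Pi.sub_apply, Pi.add_apply, smul_eq_mul]
  have hI := Complex.I_ne_zero
  field_simp
  rw [Complex.I_sq]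
  linear_combination (-2 * z * (matA n α τ ζ s *ᵥ pVec n α τ ζ s p₀ z) i) * hζ1

end

/-! ### Differentiability in `t` -/

theorem differentiableAt_conj_iff {f : ℝ → ℂ} {t : ℝ} :
    DifferentiableAt ℝ (fun u => conj (f u)) t ↔ DifferentiableAt ℝ f t :=
  Complex.conjCLE.comp_differentiableAt_iff

theorem differentiableAt_rho {f : ℝ → ℂ} {t : ℝ} (hf : DifferentiableAt ℝ f t) (h : ‖f t‖ < 1) :
    DifferentiableAt ℝ (fun u => (rho (f u) : ℂ)) t := by
  refine Complex.ofRealCLM.differentiableAt.comp t ?_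
  refine (((differentiableAt_const (1 : ℝ)).sub (hf.norm_sq ℝ)).sqrt ?_)
  have := norm_nonneg (f t)
  simp only [Pi.sub_apply]
  nlinarith

/-- Only `G` is assumed differentiable. Entry `c` of its first row is `ρ_0 ⋯ ρ_{c-1}` times `conj
α_c` (or `conj τ`), and the product is nonzero, so induction on `c` recovers the coefficients one by
one. -/
theorem differentiableAt_coefficients {n : ℕ} {α : ℝ → ℕ → ℂ} {τ : ℝ → ℂ} {t : ℝ}
    (hα : ∀ᶠ u in 𝓝 t, ∀ j < n, ‖α u j‖ < 1)
    (hG : ∀ i k, DifferentiableAt ℝ (fun u => matG n (α u) (τ u) i k) t) :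
    (∀ j < n, DifferentiableAt ℝ (fun u => α u j) t) ∧ DifferentiableAt ℝ τ t := by
  have key : ∀ (c : ℕ) (hc : c ≤ n), (∀ j < c, DifferentiableAt ℝ (fun u => α u j) t) →
      DifferentiableAt ℝ (fun u => if c = n then τ u else α u c) t := by
    intro c hc hd
    have hne : ∀ u, (∀ j < n, ‖α u j‖ < 1) → ∏ i ∈ Finset.range c, (rho (α u i) : ℂ) ≠ 0 :=
      fun u hu => Finset.prod_ne_zero_iff.2 fun i hi =>
        rho_ne_zero (hu i ((Finset.mem_range.1 hi).trans_le hc))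
    have hρ : DifferentiableAt ℝ (fun u => ∏ i ∈ Finset.range c, (rho (α u i) : ℂ)) t :=
      DifferentiableAt.fun_finsetProd fun i hi => differentiableAt_rho (hd i (Finset.mem_range.1 hi))
        (hα.self_of_nhds i ((Finset.mem_range.1 hi).trans_le hc))
    rw [← differentiableAt_conj_iff]
    refine ((hG 0 ⟨c, Nat.lt_succ_of_le hc⟩).fun_div hρ
      (hne t hα.self_of_nhds)).congr_of_eventuallyEq ?_
    filter_upwards [hα] with u hu
    rw [matG_zero_row, mul_div_cancel_left₀ _ (hne u hu)]
    simp only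
    split_ifs <;> rfl
  have hd : ∀ j < n, DifferentiableAt ℝ (fun u => α u j) t := by
    intro j
    induction j using Nat.strong_induction_on with
    | _ j ih =>
      intro hj
      simpa only [hj.ne, if_false] using key j hj.le fun i hi => ih i hi (hi.trans hj)
  exact ⟨hd, by simpa only [if_true] using key n le_rfl hd⟩

section Differentiable

variable {n : ℕ} {α : ℝ → ℕ → ℂ} {τ : ℝ → ℂ} {ζ s : ℂ} {t : ℝ}

theorem differentiableAt_tau (hα : ∀ j < n, ‖α t j‖ < 1) (hτ : ‖τ t‖ = 1) (hζ : ‖ζ‖ = 1)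
    (hdα : ∀ j < n, DifferentiableAt ℝ (fun u => α u j) t) (hdτ : DifferentiableAt ℝ τ t) {k : ℕ}
    (hk : k ≤ n) : DifferentiableAt ℝ (fun u => tau n (α u) (τ u) ζ k) t := by
  induction hk using Nat.decreasingInduction with
  | self => simpa only [tau_last] using hdτ
  | of_succ k hk ih =>
    simp only [tau_of_lt _ _ _ _ k hk]
    have ha := hdα k hk
    refine (((differentiableAt_const _).mul ha).add ih).fun_div
      (((differentiableAt_conj_iff.2 ha).mul ih).add (differentiableAt_const _)) ?_
    exact conj_mul_add_ne_zero (hα k hk) (norm_tau hα hτ hζ _) hζ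

theorem differentiableAt_beta (hα : ∀ j < n, ‖α t j‖ < 1) (hτ : ‖τ t‖ = 1) (hζ : ‖ζ‖ = 1)
    (hs : s ^ 2 = ζ) (h0 : conj ζ - tau n (α t) (τ t) ζ 0 ≠ 0)
    (hdα : ∀ j < n, DifferentiableAt ℝ (fun u => α u j) t) (hdτ : DifferentiableAt ℝ τ t) {k : ℕ}
    (hk : k ≤ n) : DifferentiableAt ℝ (fun u => beta n (α u) (τ u) ζ s k) t := by
  have hs0 : s ≠ 0 := norm_ne_zero_iff.1 (by rw [norm_sqrt hζ hs]; simp)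
  have hdt := fun {k : ℕ} (hk : k ≤ n) => differentiableAt_tau hα hτ hζ hdα hdτ hk
  induction k with
  | zero =>
    simp only [beta_zero hζ hs]
    exact (differentiableAt_const _).fun_div ((differentiableAt_const _).mul
      ((differentiableAt_const _).sub (hdt (Nat.zero_le n)))) (mul_ne_zero hs0 h0)
  | succ k ih =>
    have hne := beta_ne_zero hα hτ hζ hs h0 hk
    rw [beta] at hne
    simp only [beta]
    have hc : DifferentiableAt ℝ (fun u => conj (if k = 0 then -1 else α u (k - 1))) t := by
      by_cases hk0 : k = 0
      · simp [hk0]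
      · simpa only [hk0, if_false] using differentiableAt_conj_iff.2 (hdα (k - 1) (by omega))
    have h1 := left_ne_zero_of_mul hne
    refine DifferentiableAt.fun_mul (DifferentiableAt.fun_mul ?_ ?_) ?_
    · exact (differentiableAt_const _).fun_div (ih (by omega))
        (ne_zero_of_one_div_ne_zero (left_ne_zero_of_mul h1))
    · exact (differentiableAt_const _).fun_div ((differentiableAt_const _).add
        ((hdt (by omega)).mul hc)) (ne_zero_of_one_div_ne_zero (right_ne_zero_of_mul h1))
    · exact (differentiableAt_const _).fun_div ((differentiableAt_const _).sub
        ((differentiableAt_conj_iff.2 (hdt (by omega))).mul (hdα k hk)))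
        (ne_zero_of_one_div_ne_zero (right_ne_zero_of_mul hne))

theorem differentiableAt_matA (hβ : ∀ k ≤ n, DifferentiableAt ℝ (fun u => beta n (α u) (τ u) ζ s k) t)
    (i k : Fin (n + 1)) : DifferentiableAt ℝ (fun u => matA n (α u) (τ u) ζ s i k) t := by
  simp only [matA, Matrix.smul_apply, Matrix.of_apply, smul_eq_mul]
  split_ifs
  · exact (differentiableAt_const _).mul (differentiableAt_conj_iff.2 (hβ i (by omega)))
  · exact differentiableAt_const _
  · exact differentiableAt_const _

theorem differentiableAt_matH (hβ : ∀ k ≤ n, DifferentiableAt ℝ (fun u => beta n (α u) (τ u) ζ s k) t)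
    (i k : Fin (n + 1)) : DifferentiableAt ℝ (fun u => matH n (α u) (τ u) ζ s i k) t :=
  ((differentiableAt_matA hβ i k).add
    (differentiableAt_conj_iff.2 (differentiableAt_matA hβ k i))).const_smul (1 / 2 : ℂ)

theorem differentiableAt_matK (hβ : ∀ k ≤ n, DifferentiableAt ℝ (fun u => beta n (α u) (τ u) ζ s k) t)
    (i k : Fin (n + 1)) : DifferentiableAt ℝ (fun u => matK n (α u) (τ u) ζ s i k) t :=
  ((differentiableAt_matA hβ i k).sub
    (differentiableAt_conj_iff.2 (differentiableAt_matA hβ k i))).const_smul (1 / (2 * Complex.I))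

theorem posDef_sqrtH {α : ℕ → ℂ} {τ : ℂ} (h : (matH n α τ ζ s).PosDef) :
    (sqrtH n α τ ζ s).PosDef :=
  Matrix.isStrictlyPositive_iff_posDef.1 (Matrix.isStrictlyPositive_iff_posDef.2 h).sqrt

open scoped Matrix.Norms.L2Operator in
theorem differentiableAt_sqrtH_matX
    (hβ : ∀ k ≤ n, DifferentiableAt ℝ (fun u => beta n (α u) (τ u) ζ s k) t)
    (hH : ∀ᶠ u in 𝓝 t, (matH n (α u) (τ u) ζ s).PosDef) (i k : Fin (n + 1)) :
    DifferentiableAt ℝ (fun u => sqrtH n (α u) (τ u) ζ s i k) t ∧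
      DifferentiableAt ℝ (fun u => matX n (α u) (τ u) ζ s i k) t := by
  have h1 : ∀ i k, DifferentiableAt ℝ (fun u => sqrtH n (α u) (τ u) ζ s i k) t :=
    hH.self_of_nhds.differentiableAt_sqrt (hH.mono fun u hu => hu.posSemidef)
      (differentiableAt_matH hβ)
  refine ⟨h1 i k, Matrix.differentiableAt_entry ?_ i k⟩
  have h2 := Matrix.differentiableAt_of_entries h1
  have h3 := Matrix.differentiableAt_of_entries (differentiableAt_matK hβ)
  have h4 : DifferentiableAt ℝ (fun u => (sqrtH n (α u) (τ u) ζ s)⁻¹) t := by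
    simp only [Matrix.nonsing_inv_eq_ringInverse]
    exact (differentiableAt_inverse (posDef_sqrtH hH.self_of_nhds).isUnit).comp t h2
  exact (h4.mul h3).mul h4

end Differentiable

/-! ### Continuity of the eigenvectors -/

section Continuity

variable {X : Type*} [TopologicalSpace X] {a : X → ℕ → ℂ} {z : X → ℂ} {x : X}

theorem continuousAt_szego (hz : ContinuousAt z x) {k : ℕ}
    (ha : ∀ j < k, ContinuousAt (fun y => a y j) x) :
    ContinuousAt (fun y => szego (a y) (z y) k) x := by
  induction k with
  | zero => exact hz.prodMk continuousAt_const
  | succ k ih =>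
    have h1 := ih fun j hj => ha j (by omega)
    have h2 := ha k (by omega)
    have h3 := Complex.continuous_conj.continuousAt.comp h2
    exact (hz.mul (h1.fst.sub (h3.mul h1.snd))).prodMk (h1.snd.sub (h2.mul h1.fst))

theorem continuous_rho : Continuous rho := by
  unfold rho; fun_prop

theorem continuousAt_eigVec (hz : ContinuousAt z x) (hz0 : z x ≠ 0) {k : ℕ}
    (ha : ∀ j < k, ContinuousAt (fun y => a y j) x) (ha1 : ∀ j < k, ‖a x j‖ < 1) :
    ContinuousAt (fun y => eigVec (a y) (z y) k) x := by
  have hR : ContinuousAt (fun y => ∏ i ∈ Finset.range k, (rho (a y i) : ℂ)) x :=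
    tendsto_finsetProd _ fun i hi => (Complex.continuous_ofReal.comp
      continuous_rho).continuousAt.comp (ha i (Finset.mem_range.1 hi))
  refine (continuousAt_szego hz ha).snd.div ((hz.pow k).mul hR) (mul_ne_zero (pow_ne_zero _ hz0) ?_)
  exact Finset.prod_ne_zero_iff.2 fun i hi => rho_ne_zero (ha1 i (Finset.mem_range.1 hi))

theorem continuousAt_pVal (hz : ContinuousAt z x) (p₀ : ℝ) {k : ℕ}
    (ha : ∀ j < k, ContinuousAt (fun y => a y j) x) :
    ContinuousAt (fun y => pVal (a y) p₀ (z y) k) x := by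
  have hc := fun j hj => Complex.continuous_conj.continuousAt.comp (ha j hj)
  induction k using Nat.twoStepInduction with
  | zero => exact continuousAt_const
  | one =>
    exact ((ha 0 one_pos).add ((hc 0 one_pos).mul hz)).mul continuousAt_const
  | more k ih1 ih2 =>
    have h1 := ih1 (fun j hj => ha j (by omega)) (fun j hj => hc j (by omega))
    have h2 := ih2 (fun j hj => ha j (by omega)) (fun j hj => hc j (by omega))
    exact (((ha (k + 1) (by omega)).add ((hc (k + 1) (by omega)).mul hz)).mul h2).sub (hz.mul h1)

end Continuity

/-! ### Derivatives of eigenvalues and of their arguments -/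

/-- The derivative of an eigenvalue along a curve of matrices, when the eigenvector depends
continuously on the parameter and gives a left eigenvector at the base point. -/
theorem hasDerivAt_eigenvalue {m : Type*} [Fintype m] {M : ℝ → Matrix m m ℂ} {M' : Matrix m m ℂ}
    {x : ℝ → m → ℂ} {l : ℝ → ℂ} {t : ℝ} (hM : ∀ i k, HasDerivAt (fun u => M u i k) (M' i k) t)
    (hx : ∀ i, ContinuousAt (fun u => x u i) t) (hne : x t ≠ 0)
    (he : ∀ᶠ u in 𝓝 t, M u *ᵥ x u = l u • x u)
    (hl : ∀ y, star (x t) ⬝ᵥ (M t *ᵥ y) = l t * (star (x t) ⬝ᵥ y)) :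
    HasDerivAt l ((star (x t) ⬝ᵥ (M' *ᵥ x t)) / (star (x t) ⬝ᵥ x t)) t := by
  have hN : star (x t) ⬝ᵥ x t ≠ 0 := fun h => hne (dotProduct_star_self_eq_zero.1 h)
  have hNc : Filter.Tendsto (fun u => star (x t) ⬝ᵥ x u) (𝓝 t) (𝓝 (star (x t) ⬝ᵥ x t)) :=
    tendsto_finsetSum _ fun i _ => tendsto_const_nhds.mul (hx i)
  rw [hasDerivAt_iff_tendsto_slope]
  have h1 : Filter.Tendsto (fun u => (∑ i, star (x t) i * ∑ k, slope (fun u => M u i k) t u * x u k) /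
      (star (x t) ⬝ᵥ x u)) (𝓝[≠] t) (𝓝 ((star (x t) ⬝ᵥ (M' *ᵥ x t)) / (star (x t) ⬝ᵥ x t))) := by
    refine Filter.Tendsto.div ?_ (hNc.mono_left nhdsWithin_le_nhds) hN
    refine tendsto_finsetSum _ fun i _ => tendsto_const_nhds.mul
      (tendsto_finsetSum _ fun k _ => ?_)
    exact (hasDerivAt_iff_tendsto_slope.1 (hM i k)).mul ((hx k).mono_left nhdsWithin_le_nhds)
  refine h1.congr' ?_
  filter_upwards [(he.and (hNc.eventually_ne hN)).filter_mono nhdsWithin_le_nhds] with u hu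
  -- Pairing with the left eigenvector gives `(x_t, (M_u - M_t) x_u) = (l_u - l_t)(x_t, x_u)`, so
  -- continuity of `x` suffices.
  have h2 : ∑ i, star (x t) i * ∑ k, slope (fun u => M u i k) t u * x u k =
      ((u - t)⁻¹ : ℝ) * (star (x t) ⬝ᵥ (M u *ᵥ x u) - star (x t) ⬝ᵥ (M t *ᵥ x u)) := by
    rw [← dotProduct_sub, ← Matrix.sub_mulVec]
    simp only [dotProduct, Matrix.mulVec, Finset.mul_sum, slope_def_module, Matrix.sub_apply,
      Complex.real_smul]
    refine Finset.sum_congr rfl fun i _ => Finset.sum_congr rfl fun k _ => by ring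
  rw [h2, hu.1, hl, dotProduct_smul, smul_eq_mul, slope_def_module, div_eq_iff hu.2,
    Complex.real_smul]
  ring

/-- Continuity keeps `θ u - θ t` inside `(-π, π)` near `t`, where it is the imaginary part of the
principal logarithm of the quotient of the exponentials. -/
theorem differentiableAt_arg {θ : ℝ → ℝ} {t : ℝ} (hθ : ContinuousAt θ t)
    (h : DifferentiableAt ℝ (fun u => Complex.exp (θ u * Complex.I)) t) :
    DifferentiableAt ℝ θ t := by
  have h1 : DifferentiableAt ℝ
      (fun u => Complex.log (Complex.exp (θ u * Complex.I) / Complex.exp (θ t * Complex.I))) t := by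
    refine ((h.fun_div (differentiableAt_const (Complex.exp (θ t * Complex.I)))
      (Complex.exp_ne_zero _)).hasDerivAt.clog_real ?_).differentiableAt
    rw [div_self (Complex.exp_ne_zero _)]
    exact Complex.one_mem_slitPlane
  have h2 : DifferentiableAt ℝ (fun u => θ t + (Complex.log (Complex.exp (θ u * Complex.I) /
      Complex.exp (θ t * Complex.I))).im) t :=
    (differentiableAt_const _).add (Complex.imCLM.differentiableAt.comp t h1)
  refine h2.congr_of_eventuallyEq ?_
  have h3 : ∀ᶠ u in 𝓝 t, |θ u - θ t| < Real.pi := by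
    have := Metric.tendsto_nhds.1 hθ Real.pi Real.pi_pos
    simpa [Real.dist_eq] using this
  filter_upwards [h3] with u hu
  rw [abs_lt] at hu
  rw [← Complex.exp_sub, ← sub_mul, ← Complex.ofReal_sub, Complex.log_exp]
  · simp
  · simpa using hu.1
  · simpa using hu.2.le

theorem deriv_exp_arg {θ : ℝ → ℝ} {t : ℝ} (h : DifferentiableAt ℝ θ t) :
    HasDerivAt (fun u => Complex.exp (θ u * Complex.I))
      (Complex.exp (θ t * Complex.I) * (deriv θ t * Complex.I)) t :=
  (h.hasDerivAt.ofReal_comp.mul_const Complex.I).cexp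

/-! ### Existence of moving eigenvalues -/

theorem pow_card_le_norm_prod {ε : ℝ} (hε : 0 ≤ ε) {z : ℂ} {S : Multiset ℂ}
    (h : ∀ r ∈ S, ε ≤ ‖z - r‖) : ε ^ S.card ≤ ‖(S.map fun r => z - r).prod‖ := by
  induction S using Multiset.induction_on with
  | empty => simp
  | cons a S ih =>
    have h1 := h a (Multiset.mem_cons_self a S)
    have h2 := ih fun r hr => h r (Multiset.mem_cons_of_mem hr)
    rw [Multiset.card_cons, pow_succ', Multiset.map_cons, Multiset.prod_cons, norm_mul]
    exact mul_le_mul h1 h2 (pow_nonneg hε _) (norm_nonneg _)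

/-- Lower semicontinuity of the spectrum of a matrix. -/
theorem eventually_exists_mem_spectrum {X m : Type*} [TopologicalSpace X] [Fintype m]
    [DecidableEq m] {M : X → Matrix m m ℂ} {x : X} (hM : ∀ i k, ContinuousAt (fun y => M y i k) x)
    {z : ℂ} (hz : z ∈ spectrum ℂ (M x)) {ε : ℝ} (hε : 0 < ε) :
    ∀ᶠ y in 𝓝 x, ∃ w ∈ spectrum ℂ (M y), ‖z - w‖ < ε := by
  have hMc : ContinuousAt M x := tendsto_pi_nhds.2 fun i => tendsto_pi_nhds.2 fun k => hM i k
  have hdet : ContinuousAt (fun y => (M y).charpoly.eval z) x := by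
    simp only [Matrix.eval_charpoly]
    have : Continuous fun A : Matrix m m ℂ => (Matrix.scalar m z - A).det :=
      (continuous_const.sub continuous_id).matrix_det
    exact this.continuousAt.comp hMc
  have h0 : (M x).charpoly.eval z = 0 := Matrix.mem_spectrum_iff_isRoot_charpoly.1 hz
  -- The characteristic polynomial at `z` is the product of the differences `z - r` over its roots;
  -- if all roots were `ε` away, its modulus would be at least `ε ^ card m`.
  have hlt : ∀ᶠ y in 𝓝 x, ‖(M y).charpoly.eval z‖ < ε ^ Fintype.card m := by
    refine hdet.norm.eventually_lt continuousAt_const ?_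
    rw [h0, norm_zero]; positivity
  filter_upwards [hlt] with y hy
  by_contra! hcon
  refine hy.not_ge ?_
  have hsp := IsAlgClosed.splits (M y).charpoly
  rw [hsp.eval_eq_prod_roots_of_monic (Matrix.charpoly_monic _)]
  have hcard : (M y).charpoly.roots.card = Fintype.card m := by
    rw [← hsp.natDegree_eq_card_roots, Matrix.charpoly_natDegree_eq_dim]
  rw [← hcard]
  exact pow_card_le_norm_prod hε.le fun r hr => hcon r
    (Matrix.mem_spectrum_iff_isRoot_charpoly.2 (Polynomial.isRoot_of_mem_roots hr))

section Branches

variable {n : ℕ} {α : ℝ → ℕ → ℂ} {τ : ℝ → ℂ} {I : Set ℝ}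

/-- Near a point of the spectrum of `G` there is at most one eigenvalue. -/
theorem exists_ball_eigenvalue_unique (hI : IsOpen I)
    (hα : ∀ t ∈ I, ∀ j < n, ‖α t j‖ < 1) (hτ : ∀ t ∈ I, ‖τ t‖ = 1) {t₀ : ℝ} (ht₀ : t₀ ∈ I)
    (hc : ∀ j < n, ContinuousAt (fun u => α u j) t₀) {z₀ : ℂ} (hz₀ : z₀ ≠ 0) :
    ∃ δ > 0, Metric.ball t₀ δ ⊆ I ∧ ∀ t ∈ Metric.ball t₀ δ, ∀ z ∈ Metric.ball z₀ δ,
      ∀ w ∈ Metric.ball z₀ δ, z ∈ spectrum ℂ (matG n (α t) (τ t)) →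
        w ∈ spectrum ℂ (matG n (α t) (τ t)) → z = w := by
  -- `F` pairs the eigenvectors for two values of `z`. It is nonzero at `(t₀, z₀, z₀)`, hence
  -- nearby, whereas eigenvectors of a unitary matrix for distinct eigenvalues are orthogonal.
  set F : ℝ × ℂ × ℂ → ℂ := fun q => (star fun i : Fin (n + 1) => eigVec (α q.1) q.2.1 i) ⬝ᵥ
    fun i : Fin (n + 1) => eigVec (α q.1) q.2.2 i with hF
  have hFc : ContinuousAt F (t₀, z₀, z₀) := by
    have ha : ∀ j < n, ContinuousAt (fun q : ℝ × ℂ × ℂ => α q.1 j) (t₀, z₀, z₀) := fun j hj =>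
      ContinuousAt.comp (f := Prod.fst) (g := fun u => α u j) (x := (t₀, z₀, z₀)) (hc j hj)
        continuousAt_fst
    refine tendsto_finsetSum _ fun i _ => Filter.Tendsto.mul ?_ ?_
    · refine (continuous_star.tendsto _).comp ?_
      exact continuousAt_eigVec (z := fun q : ℝ × ℂ × ℂ => q.2.1) (by fun_prop) hz₀
        (fun j hj => ha j (by omega)) (fun j hj => hα t₀ ht₀ j (by omega))
    · exact continuousAt_eigVec (z := fun q : ℝ × ℂ × ℂ => q.2.2) (by fun_prop) hz₀
        (fun j hj => ha j (by omega)) (fun j hj => hα t₀ ht₀ j (by omega))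
  have hF0 : F (t₀, z₀, z₀) ≠ 0 := fun h => by
    have := congrFun (dotProduct_star_self_eq_zero.1 h) 0
    simp [eigVec, szego] at this
  obtain ⟨δ₁, hδ₁, h1⟩ := Metric.eventually_nhds_iff_ball.1 (hFc.eventually_ne hF0)
  obtain ⟨δ₂, hδ₂, h2⟩ := Metric.isOpen_iff.1 hI t₀ ht₀
  refine ⟨min δ₁ δ₂, lt_min hδ₁ hδ₂, fun u hu => h2 (Metric.ball_subset_ball (min_le_right _ _) hu),
    fun t ht z hz w hw hzS hwS => ?_⟩
  have htI := h2 (Metric.ball_subset_ball (min_le_right _ _) ht)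
  have hU := matG_mem_unitary (hα t htI) (hτ t htI)
  have hz1 := norm_eq_one_of_mem_spectrum hU hzS
  have hw1 := norm_eq_one_of_mem_spectrum hU hwS
  have hz0 : z ≠ 0 := norm_ne_zero_iff.1 (by rw [hz1]; simp)
  have hw0 : w ≠ 0 := norm_ne_zero_iff.1 (by rw [hw1]; simp)
  have ez := matG_mulVec_eigVec (hα t htI) hz0 ((mem_spectrum_matG_iff (hα t htI) hz0).1 hzS)
  have ew := matG_mulVec_eigVec (hα t htI) hw0 ((mem_spectrum_matG_iff (hα t htI) hw0).1 hwS)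
  have e := star_vecMul_of_unitary hU hz1 ez (fun i : Fin (n + 1) => eigVec (α t) w i)
  rw [ew, dotProduct_smul, smul_eq_mul] at e
  have hne : F (t, z, w) ≠ 0 := by
    refine h1 _ ?_
    rw [← ball_prod_same, ← ball_prod_same]
    exact ⟨Metric.ball_subset_ball (min_le_left _ _) ht,
      Metric.ball_subset_ball (min_le_left _ _) hz, Metric.ball_subset_ball (min_le_left _ _) hw⟩
  exact (mul_right_cancel₀ hne e).symm

/-- Lower semicontinuity provides an eigenvalue close to `z₀` for each `t` near `t₀`, and local
uniqueness makes any such choice continuous. -/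
theorem exists_isEigenArg (hI : IsOpen I)
    (hα : ∀ t ∈ I, ∀ j < n, ‖α t j‖ < 1) (hτ : ∀ t ∈ I, ‖τ t‖ = 1)
    (hG : ∀ t ∈ I, ∀ i k, ContinuousAt (fun t => matG n (α t) (τ t) i k) t) {t₀ : ℝ} (ht₀ : t₀ ∈ I)
    (hc : ∀ j < n, ContinuousAt (fun u => α u j) t₀) {z₀ : ℂ}
    (hz₀ : z₀ ∈ spectrum ℂ (matG n (α t₀) (τ t₀))) :
    ∃ J : Set ℝ, IsOpen J ∧ J.OrdConnected ∧ J ⊆ I ∧ t₀ ∈ J ∧ ∃ θ : ℝ → ℝ,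
      IsEigenArg (fun t => matG n (α t) (τ t)) J θ ∧ Complex.exp (θ t₀ * Complex.I) = z₀ := by
  have hz1 := norm_eq_one_of_mem_spectrum (matG_mem_unitary (hα t₀ ht₀) (hτ t₀ ht₀)) hz₀
  have hz0 : z₀ ≠ 0 := norm_ne_zero_iff.1 (by rw [hz1]; simp)
  obtain ⟨δ, hδ, hδI, huniq⟩ := exists_ball_eigenvalue_unique hI hα hτ ht₀ hc hz0
  -- The bound `1` keeps `η t / z₀` in the unit ball about `1`, where `arg` is continuous.
  set ε := min δ 1
  have hε0 : 0 < ε := lt_min hδ one_pos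
  obtain ⟨r, hr, hex⟩ := Metric.eventually_nhds_iff_ball.1
    (eventually_exists_mem_spectrum (hG t₀ ht₀) hz₀ hε0)
  have hδ' : Metric.ball t₀ (min δ r) ⊆ Metric.ball t₀ δ := Metric.ball_subset_ball (min_le_left _ _)
  have hr' : Metric.ball t₀ (min δ r) ⊆ Metric.ball t₀ r := Metric.ball_subset_ball (min_le_right _ _)
  have hex' : ∀ t, ∃ w, t ∈ Metric.ball t₀ (min δ r) →
      w ∈ spectrum ℂ (matG n (α t) (τ t)) ∧ ‖z₀ - w‖ < ε := by
    intro t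
    by_cases ht : t ∈ Metric.ball t₀ (min δ r)
    · obtain ⟨w, hw⟩ := hex t (hr' ht)
      exact ⟨w, fun _ => hw⟩
    · exact ⟨0, fun h => absurd h ht⟩
  choose η hη using hex'
  set J := Metric.ball t₀ (min δ r) with hJ
  have ht₀J : t₀ ∈ J := Metric.mem_ball_self (lt_min hδ hr)
  have hball : ∀ {w : ℂ}, ‖z₀ - w‖ < ε → w ∈ Metric.ball z₀ δ := fun hw => by
    rw [Metric.mem_ball, dist_comm, dist_eq_norm]; exact hw.trans_le (min_le_left _ _)
  have hη0 : η t₀ = z₀ := huniq t₀ (hδ' ht₀J) _ (hball (hη t₀ ht₀J).2) _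
    (Metric.mem_ball_self hδ) (hη t₀ ht₀J).1 hz₀
  have hηc : ∀ t ∈ J, ContinuousAt η t := by
    intro t ht
    rw [Metric.continuousAt_iff']
    intro e he
    -- The second bound keeps the nearby eigenvalue within `ε` of `z₀`, so uniqueness identifies it
    -- with `η u`.
    have hpos : 0 < min e (ε - ‖z₀ - η t‖) := lt_min he (sub_pos.2 (hη t ht).2)
    filter_upwards [eventually_exists_mem_spectrum (hG t (hδI (hδ' ht))) (hη t ht).1 hpos,
      Metric.isOpen_ball.mem_nhds ht] with u ⟨w, hw, hwd⟩ hu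
    have hw' : ‖z₀ - w‖ < ε := by
      calc ‖z₀ - w‖ = ‖(z₀ - η t) + (η t - w)‖ := by ring_nf
        _ ≤ ‖z₀ - η t‖ + ‖η t - w‖ := norm_add_le _ _
        _ < ε := by linarith [hwd.trans_le (min_le_right e _)]
    have : η u = w := huniq u (hδ' hu) _ (hball (hη u hu).2) _ (hball hw') (hη u hu).1 hw
    rw [this, dist_comm, dist_eq_norm]
    exact hwd.trans_le (min_le_left _ _)
  have hη1 : ∀ t ∈ J, ‖η t‖ = 1 := fun t ht => norm_eq_one_of_mem_spectrum
    (matG_mem_unitary (hα t (hδI (hδ' ht))) (hτ t (hδI (hδ' ht)))) (hη t ht).1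
  have hexp : ∀ t ∈ J,
      Complex.exp ((Complex.arg z₀ + Complex.arg (η t / z₀) : ℝ) * Complex.I) = η t := by
    intro t ht
    have e1 := Complex.norm_mul_exp_arg_mul_I z₀
    have e2 := Complex.norm_mul_exp_arg_mul_I (η t / z₀)
    rw [hz1] at e1
    rw [norm_div, hz1, hη1 t ht] at e2
    rw [Complex.ofReal_add, add_mul, Complex.exp_add]
    simp only [Complex.ofReal_one, one_mul, div_one] at e1 e2
    rw [e1, e2, mul_div_cancel₀ _ hz0]
  refine ⟨J, Metric.isOpen_ball, ?_, hδ'.trans hδI, ht₀J,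
    fun t => Complex.arg z₀ + Complex.arg (η t / z₀), ⟨fun t ht => ContinuousAt.continuousWithinAt ?_,
      fun t ht => ?_⟩, ?_⟩
  · rw [hJ, Real.ball_eq_Ioo]; exact Set.ordConnected_Ioo
  · refine continuousAt_const.add ?_
    have hslit : η t / z₀ ∈ Complex.slitPlane := by
      refine Complex.ball_one_subset_slitPlane ?_
      rw [Metric.mem_ball, dist_comm, dist_eq_norm, one_sub_div hz0, norm_div, hz1, div_one]
      exact (hη t ht).2.trans_le (min_le_right _ _)
    exact ContinuousAt.comp (f := fun u => η u / z₀) (Complex.continuousAt_arg hslit)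
      ((hηc t ht).div_const z₀)
  · rw [hexp t ht]; exact (hη t ht).1
  · rw [hexp t₀ ht₀J, hη0]

end Branches

/-! ### Cayley transform and the criterion -/

theorem conj_cayley {z ζ : ℂ} (hz : ‖z‖ = 1) (hζ : ‖ζ‖ = 1) (hne : z ≠ ζ) :
    conj (Complex.I * (z + ζ) / (z - ζ)) = Complex.I * (z + ζ) / (z - ζ) := by
  have h1 := mul_conj_eq_one hz
  have h2 := mul_conj_eq_one hζ
  have h3 := sub_ne_zero.2 hne
  have h4 : conj z - conj ζ ≠ 0 := by rw [← map_sub]; exact (map_ne_zero _).2 h3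
  simp only [map_div₀, map_mul, map_add, map_sub, Complex.conj_I]
  rw [div_eq_div_iff h4 h3]
  linear_combination (-2 * Complex.I) * (h1 - h2)

/-- The Cayley transform reverses the direction of motion. -/
theorem hasDerivAt_cayley {θ : ℝ → ℝ} {t : ℝ} (h : DifferentiableAt ℝ θ t) {ζ : ℂ} (hζ : ‖ζ‖ = 1)
    (hne : Complex.exp (θ t * Complex.I) ≠ ζ) :
    HasDerivAt (fun u => Complex.I * (Complex.exp (θ u * Complex.I) + ζ) /
      (Complex.exp (θ u * Complex.I) - ζ))
      ((-2 * deriv θ t / ‖Complex.exp (θ t * Complex.I) - ζ‖ ^ 2 : ℝ) : ℂ) t := by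
  have h1 := deriv_exp_arg h
  have hz : ‖Complex.exp (θ t * Complex.I)‖ = 1 := Complex.norm_exp_ofReal_mul_I _
  have h2 := ((h1.add_const ζ).const_mul Complex.I).fun_div (h1.sub_const ζ) (sub_ne_zero.2 hne)
  refine h2.congr_deriv (Eq.symm ?_)
  have e1 := mul_conj_eq_one hz
  have e2 := mul_conj_eq_one hζ
  have e3 := sub_ne_zero.2 hne
  set z := Complex.exp (θ t * Complex.I)
  have e4 : conj z - conj ζ ≠ 0 := by rw [← map_sub]; exact (map_ne_zero _).2 e3
  have e5 : ((‖z - ζ‖ ^ 2 : ℝ) : ℂ) = (z - ζ) * (conj z - conj ζ) := by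
    rw [← map_sub, Complex.mul_conj, Complex.normSq_eq_norm_sq]
  rw [Complex.ofReal_div, e5]
  push_cast
  rw [div_eq_div_iff (mul_ne_zero e3 e4) (pow_ne_zero _ e3)]
  -- This turns the denominator `|z - ζ|²` into a multiple of `(z - ζ)²`.
  have e6 : (z - ζ) = -(z * ζ * (conj z - conj ζ)) := by
    linear_combination ζ * e1 - z * e2
  have hI := Complex.I_sq
  linear_combination (-2 * ((deriv θ t : ℝ) : ℂ) * (z - ζ)) * e6 +
    2 * (((deriv θ t : ℝ) : ℂ) * (z - ζ)) * z * ζ * (conj z - conj ζ) * hI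

theorem isHermitian_matK (n : ℕ) (α : ℕ → ℂ) (τ ζ s : ℂ) : (matK n α τ ζ s).IsHermitian := by
  have h : star (1 / (2 * Complex.I)) = -(1 / (2 * Complex.I)) := by
    simp
  rw [Matrix.IsHermitian, matK, Matrix.conjTranspose_smul, h, Matrix.conjTranspose_sub,
    Matrix.conjTranspose_conjTranspose, neg_smul, ← smul_neg, neg_sub]

section Criterion

variable {n : ℕ} {α : ℕ → ℂ} {τ ζ s : ℂ}

theorem sqrtH_mul_self (h : (matH n α τ ζ s).PosDef) :
    sqrtH n α τ ζ s * sqrtH n α τ ζ s = matH n α τ ζ s :=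
  CFC.sqrt_mul_sqrt_self _ (Matrix.nonneg_iff_posSemidef.2 h.posSemidef)

theorem isHermitian_matX (h : (matH n α τ ζ s).PosDef) : (matX n α τ ζ s).IsHermitian := by
  have h1 : (sqrtH n α τ ζ s)⁻¹ᴴ = (sqrtH n α τ ζ s)⁻¹ := (posDef_sqrtH h).isHermitian.inv
  rw [Matrix.IsHermitian, matX, Matrix.conjTranspose_mul, Matrix.conjTranspose_mul, h1,
    (isHermitian_matK n α τ ζ s).eq, Matrix.mul_assoc]

theorem matX_mulVec (h : (matH n α τ ζ s).PosDef) {p : Fin (n + 1) → ℂ} {l : ℂ}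
    (hp : matK n α τ ζ s *ᵥ p = l • (matH n α τ ζ s *ᵥ p)) :
    matX n α τ ζ s *ᵥ (sqrtH n α τ ζ s *ᵥ p) = l • (sqrtH n α τ ζ s *ᵥ p) := by
  have hu : IsUnit (sqrtH n α τ ζ s).det :=
    (Matrix.isUnit_iff_isUnit_det _).1 (posDef_sqrtH h).isUnit
  rw [matX, Matrix.mulVec_mulVec, Matrix.mul_assoc, Matrix.nonsing_inv_mul _ hu, Matrix.mul_one,
    ← Matrix.mulVec_mulVec, hp, Matrix.mulVec_smul, Matrix.mulVec_mulVec, ← sqrtH_mul_self h,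
    Matrix.nonsing_inv_mul_cancel_left _ _ hu]

theorem matK_mulVec_of_mem_spectrum (hα : ∀ j < n, ‖α j‖ < 1) (hτ : ‖τ‖ = 1) (hζ : ‖ζ‖ = 1)
    (hs : s ^ 2 = ζ) (h0 : conj ζ - tau n α τ ζ 0 ≠ 0) (p₀ : ℝ) {z : ℂ}
    (hz : z ∈ spectrum ℂ (matG n α τ)) (hne : z ≠ ζ) :
    matK n α τ ζ s *ᵥ pVec n α τ ζ s p₀ z =
      (Complex.I * (z + ζ) / (z - ζ)) • (matH n α τ ζ s *ᵥ pVec n α τ ζ s p₀ z) := by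
  refine matK_mulVec_pVec hζ hs ?_ hne
  have hz1 := norm_eq_one_of_mem_spectrum (matG_mem_unitary hα hτ) hz
  have hz0 : z ≠ 0 := norm_ne_zero_iff.1 (by rw [hz1]; simp)
  rw [pVal_succ hα hτ hζ hs h0 p₀ z le_rfl, tau_last, (mem_spectrum_matG_iff hα hz0).1 hz, mul_zero]

end Criterion

section Moving

variable {n : ℕ} {α : ℝ → ℕ → ℂ} {τ : ℝ → ℂ} {ζ s : ℂ} {t : ℝ}

/-- The condition `τ_0(ζ) ≠ conj ζ` persists near `t` by continuity of `τ_0`, and it is all that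
`posDef_matH` needs about `ζ`. -/
theorem eventually_posDef_matH (hα : ∀ᶠ u in 𝓝 t, ∀ j < n, ‖α u j‖ < 1)
    (hτ : ∀ᶠ u in 𝓝 t, ‖τ u‖ = 1)
    (hdα : ∀ j < n, DifferentiableAt ℝ (fun u => α u j) t) (hdτ : DifferentiableAt ℝ τ t)
    (hζ : ‖ζ‖ = 1) (hs : s ^ 2 = ζ) (h0 : conj ζ - tau n (α t) (τ t) ζ 0 ≠ 0) :
    ∀ᶠ u in 𝓝 t, conj ζ - tau n (α u) (τ u) ζ 0 ≠ 0 ∧ (matH n (α u) (τ u) ζ s).PosDef := by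
  have hc : ContinuousAt (fun u => conj ζ - tau n (α u) (τ u) ζ 0) t :=
    continuousAt_const.sub (differentiableAt_tau hα.self_of_nhds hτ.self_of_nhds hζ hdα hdτ
      (Nat.zero_le n)).continuousAt
  filter_upwards [hc.eventually_ne h0, hα, hτ] with u hu hu1 hu2
  exact ⟨hu, posDef_matH hu1 hu2 hζ hs hu⟩

/-- Works with `G` and `eigVec` instead of the pencil, so `ζ` plays no role and times with `ζ` in
the spectrum are included. -/
theorem differentiableAt_of_isEigenArg (hα : ∀ᶠ u in 𝓝 t, ∀ j < n, ‖α u j‖ < 1)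
    (hτ : ∀ᶠ u in 𝓝 t, ‖τ u‖ = 1) (hdα : ∀ j < n, DifferentiableAt ℝ (fun u => α u j) t)
    (hG : ∀ i k, DifferentiableAt ℝ (fun u => matG n (α u) (τ u) i k) t) {θ : ℝ → ℝ}
    (hθ : ContinuousAt θ t)
    (he : ∀ᶠ u in 𝓝 t, Complex.exp (θ u * Complex.I) ∈ spectrum ℂ (matG n (α u) (τ u))) :
    DifferentiableAt ℝ θ t := by
  refine differentiableAt_arg hθ ?_
  have hz : ContinuousAt (fun u => Complex.exp (θ u * Complex.I)) t := by fun_prop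
  have he' : ∀ᶠ u in 𝓝 t, (matG n (α u) (τ u) *ᵥ fun i : Fin (n + 1) =>
      eigVec (α u) (Complex.exp (θ u * Complex.I)) i) =
        Complex.exp (θ u * Complex.I) • fun i : Fin (n + 1) =>
          eigVec (α u) (Complex.exp (θ u * Complex.I)) i := by
    filter_upwards [hα, he] with u hu hu2
    exact matG_mulVec_eigVec hu (Complex.exp_ne_zero _)
      ((mem_spectrum_matG_iff hu (Complex.exp_ne_zero _)).1 hu2)
  refine (hasDerivAt_eigenvalue (M := fun u => matG n (α u) (τ u))
    (M' := Matrix.of fun i k => deriv (fun u => matG n (α u) (τ u) i k) t)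
    (x := fun u (i : Fin (n + 1)) => eigVec (α u) (Complex.exp (θ u * Complex.I)) i)
    (fun i k => (hG i k).hasDerivAt) (fun i => ?_) (fun h => ?_) he' ?_).differentiableAt
  · exact continuousAt_eigVec hz (Complex.exp_ne_zero _)
      (fun j hj => (hdα j (by omega)).continuousAt) (fun j hj => hα.self_of_nhds j (by omega))
  · simpa [eigVec, szego] using congrFun h 0
  · exact star_vecMul_of_unitary (matG_mem_unitary hα.self_of_nhds hτ.self_of_nhds)
      (Complex.norm_exp_ofReal_mul_I _) he'.self_of_nhds

/-- The value of the quadratic form at a moving eigenvalue. -/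
theorem exists_form_eq (hα : ∀ᶠ u in 𝓝 t, ∀ j < n, ‖α u j‖ < 1)
    (hτ : ∀ᶠ u in 𝓝 t, ‖τ u‖ = 1) (hdα : ∀ j < n, DifferentiableAt ℝ (fun u => α u j) t)
    (hdτ : DifferentiableAt ℝ τ t) (hζ : ‖ζ‖ = 1) (hs : s ^ 2 = ζ) {p₀ : ℝ} (hp₀ : p₀ ≠ 0)
    {θ : ℝ → ℝ} (hθ : DifferentiableAt ℝ θ t)
    (he : ∀ᶠ u in 𝓝 t, Complex.exp (θ u * Complex.I) ∈ spectrum ℂ (matG n (α u) (τ u)))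
    (hS : ζ ∉ spectrum ℂ (matG n (α t) (τ t))) :
    ∃ c : ℝ, 0 < c ∧
      form n α τ ζ s p₀ (Complex.exp (θ t * Complex.I)) t = ((-(c * deriv θ t) : ℝ) : ℂ) := by
  have h0 := beta_denominator_ne_zero hα.self_of_nhds hτ.self_of_nhds hζ hS
  have hdβ := fun k hk => differentiableAt_beta hα.self_of_nhds hτ.self_of_nhds hζ hs h0 hdα hdτ
    (k := k) hk
  have hpos := eventually_posDef_matH hα hτ hdα hdτ hζ hs h0
  have hH := hpos.self_of_nhds.2
  have hd := differentiableAt_sqrtH_matX hdβ (hpos.mono fun u hu => hu.2)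
  have hne : Complex.exp (θ t * Complex.I) ≠ ζ := fun h => hS (h ▸ he.self_of_nhds)
  have hz : ContinuousAt (fun u => Complex.exp (θ u * Complex.I)) t := by
    have := hθ.continuousAt
    fun_prop
  set l : ℝ → ℂ := fun u => Complex.I * (Complex.exp (θ u * Complex.I) + ζ) /
      (Complex.exp (θ u * Complex.I) - ζ)
  set p : ℝ → Fin (n + 1) → ℂ := fun u =>
    pVec n (α u) (τ u) ζ s p₀ (Complex.exp (θ u * Complex.I)) with hp
  set v : ℝ → Fin (n + 1) → ℂ := fun u => sqrtH n (α u) (τ u) ζ s *ᵥ p u with hv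
  have hR := posDef_sqrtH hH
  have hpc : ∀ i, ContinuousAt (fun u => p u i) t := fun i =>
    continuousAt_pVal hz p₀ fun j hj => (hdβ j (by omega)).continuousAt
  have hvc : ∀ i, ContinuousAt (fun u => v u i) t := fun i => by
    change ContinuousAt (fun u => ∑ k, sqrtH n (α u) (τ u) ζ s i k * p u k) t
    exact tendsto_finsetSum _ fun k _ => (hd i k).1.continuousAt.mul (hpc k)
  have hp0 : p t ≠ 0 := fun h => by
    have := congrFun h 0
    simp [hp, pVec, pVal, hp₀] at this
  have hv0 : v t ≠ 0 := fun h => hp0 (Matrix.mulVec_injective_of_isUnit hR.isUnit (by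
    rw [Matrix.mulVec_zero]; exact h))
  have hev : ∀ᶠ u in 𝓝 t, matX n (α u) (τ u) ζ s *ᵥ v u = l u • v u := by
    filter_upwards [hα, hτ, hpos, he, hz.eventually_ne hne] with u h1 h2 h3 h4 h5
    exact matX_mulVec h3.2 (matK_mulVec_of_mem_spectrum h1 h2 hζ hs h3.1 p₀ h4 h5)
  have hleft : ∀ y, star (v t) ⬝ᵥ (matX n (α t) (τ t) ζ s *ᵥ y) = l t * (star (v t) ⬝ᵥ y) := by
    intro y
    have h1 := congrArg star hev.self_of_nhds
    rw [Matrix.star_mulVec, (isHermitian_matX hH).eq, star_smul] at h1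
    rw [Matrix.dotProduct_mulVec, h1, smul_dotProduct, smul_eq_mul]
    congr 1
    exact conj_cayley (Complex.norm_exp_ofReal_mul_I _) hζ hne
  have hder := hasDerivAt_eigenvalue (M := fun u => matX n (α u) (τ u) ζ s)
    (M' := matDeriv (fun u => matX n (α u) (τ u) ζ s) t)
    (fun i k => (hd i k).2.hasDerivAt) hvc hv0 hev hleft
  -- The Hellmann–Feynman quotient and the derivative of the Cayley transform are derivatives of the
  -- same function `l`.
  have huniq := hder.unique (hasDerivAt_cayley hθ hζ hne)
  have hN : 0 < star (v t) ⬝ᵥ v t := dotProduct_star_self_pos_iff.2 hv0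
  have hNr : star (v t) ⬝ᵥ v t = ((star (v t) ⬝ᵥ v t).re : ℂ) :=
    (Complex.eq_re_of_ofReal_le hN.le)
  have hNpos : 0 < (star (v t) ⬝ᵥ v t).re := (Complex.pos_iff.1 hN).1
  have hform : form n α τ ζ s p₀ (Complex.exp (θ t * Complex.I)) t =
      star (v t) ⬝ᵥ (matDeriv (fun u => matX n (α u) (τ u) ζ s) t *ᵥ v t) := by
    rw [form, hv]
    simp only
    rw [Matrix.star_mulVec, hR.isHermitian.eq, ← Matrix.dotProduct_mulVec, Matrix.mulVec_mulVec,
      Matrix.mulVec_mulVec, Matrix.mul_assoc]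
  have hd2 : 0 < ‖Complex.exp (θ t * Complex.I) - ζ‖ ^ 2 :=
    pow_pos (norm_pos_iff.2 (sub_ne_zero.2 hne)) 2
  refine ⟨2 * (star (v t) ⬝ᵥ v t).re / ‖Complex.exp (θ t * Complex.I) - ζ‖ ^ 2, by positivity, ?_⟩
  rw [hform, (div_eq_iff hN.ne').1 huniq, hNr, ← Complex.ofReal_mul]
  congr 1
  rw [← hNr]
  ring

end Moving

end POPUC

/-! ### Assembly of the theorem -/

theorem mainTheorem2 (n : ℕ) (I : Set ℝ) (hI : IsOpen I) (hIc : I.OrdConnected)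
    (α : ℝ → ℕ → ℂ) (τ : ℝ → ℂ)
    (hα : ∀ t ∈ I, ∀ j < n, ‖α t j‖ < 1) (hτ : ∀ t ∈ I, ‖τ t‖ = 1)
    (hG : ∀ i k, DifferentiableOn ℝ (fun t => POPUC.matG n (α t) (τ t) i k) I)
    (ζ s : ℂ) (hζ : ‖ζ‖ = 1) (hs : s ^ 2 = ζ) (p₀ : ℝ) (hp₀ : p₀ ≠ 0) :
    -- the eigenvalues are the zeros of the paraorthogonal polynomial
    (∀ t ∈ I, ∀ z : ℂ, (POPUC.popuc n (α t) (τ t)).IsRoot z ↔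
      z ∈ spectrum ℂ (POPUC.matG n (α t) (τ t))) ∧
    -- the objects in the criterion are well defined
    (∀ t ∈ I, ζ ∉ spectrum ℂ (POPUC.matG n (α t) (τ t)) →
      (POPUC.matH n (α t) (τ t) ζ s).PosDef ∧
      ∀ i k, DifferentiableAt ℝ (fun u => POPUC.matX n (α u) (τ u) ζ s i k) t) ∧
    -- every eigenvalue belongs to a moving eigenvalue
    (∀ t₀ ∈ I, ∀ η ∈ spectrum ℂ (POPUC.matG n (α t₀) (τ t₀)),
      ∃ J : Set ℝ, IsOpen J ∧ J.OrdConnected ∧ J ⊆ I ∧ t₀ ∈ J ∧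
        ∃ θ : ℝ → ℝ, POPUC.IsEigenArg (fun t => POPUC.matG n (α t) (τ t)) J θ ∧
          Complex.exp (θ t₀ * Complex.I) = η) ∧
    -- the criterion, for every moving eigenvalue `exp (i θ(t))`
    (∀ J : Set ℝ, IsOpen J → J.OrdConnected → J ⊆ I → ∀ θ : ℝ → ℝ,
      POPUC.IsEigenArg (fun t => POPUC.matG n (α t) (τ t)) J θ →
      (∀ t ∈ J, DifferentiableAt ℝ θ t) ∧
      (∀ t ∈ J, ζ ∉ spectrum ℂ (POPUC.matG n (α t) (τ t)) →
        (0 < deriv θ t ↔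
          POPUC.form n α τ ζ s p₀ (Complex.exp (θ t * Complex.I)) t < 0)) ∧
      (∀ T : Set ℝ, T ⊆ J → T.OrdConnected →
        (∀ t ∈ T, ζ ∉ spectrum ℂ (POPUC.matG n (α t) (τ t)) ∧
          POPUC.form n α τ ζ s p₀ (Complex.exp (θ t * Complex.I)) t < 0) →
        StrictMonoOn θ T)) := by
  have hGd : ∀ t ∈ I, ∀ i k, DifferentiableAt ℝ (fun u => POPUC.matG n (α u) (τ u) i k) t :=
    fun t ht i k => (hG i k).differentiableAt (hI.mem_nhds ht)
  have hα' : ∀ t ∈ I, ∀ᶠ u in 𝓝 t, ∀ j < n, ‖α u j‖ < 1 := fun t ht =>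
    (hI.eventually_mem ht).mono hα
  have hτ' : ∀ t ∈ I, ∀ᶠ u in 𝓝 t, ‖τ u‖ = 1 := fun t ht => (hI.eventually_mem ht).mono hτ
  have hcoef := fun t (ht : t ∈ I) => POPUC.differentiableAt_coefficients (hα' t ht) (hGd t ht)
  refine ⟨fun t _ z => Matrix.mem_spectrum_iff_isRoot_charpoly.symm, fun t ht hS => ?_,
    fun t₀ ht₀ η hη => ?_, fun J hJ hJc hJI θ hθ => ?_⟩
  · have h0 := POPUC.beta_denominator_ne_zero (hα t ht) (hτ t ht) hζ hS
    have hpos := POPUC.eventually_posDef_matH (hα' t ht) (hτ' t ht) (hcoef t ht).1 (hcoef t ht).2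
      hζ hs h0
    exact ⟨hpos.self_of_nhds.2, fun i k => (POPUC.differentiableAt_sqrtH_matX
      (fun k hk => POPUC.differentiableAt_beta (hα t ht) (hτ t ht) hζ hs h0 (hcoef t ht).1
        (hcoef t ht).2 hk) (hpos.mono fun u hu => hu.2) i k).2⟩
  · exact POPUC.exists_isEigenArg hI hα hτ (fun t ht i k => (hGd t ht i k).continuousAt) ht₀
      (fun j hj => ((hcoef t₀ ht₀).1 j hj).continuousAt) hη
  · have he : ∀ t ∈ J, ∀ᶠ u in 𝓝 t, Complex.exp (θ u * Complex.I) ∈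
        spectrum ℂ (POPUC.matG n (α u) (τ u)) := fun t ht => (hJ.eventually_mem ht).mono hθ.2
    have hd : ∀ t ∈ J, DifferentiableAt ℝ θ t := fun t ht =>
      POPUC.differentiableAt_of_isEigenArg (hα' t (hJI ht)) (hτ' t (hJI ht)) (hcoef t (hJI ht)).1
        (hGd t (hJI ht)) (hθ.1.continuousAt (hJ.mem_nhds ht)) (he t ht)
    have hcrit : ∀ t ∈ J, ζ ∉ spectrum ℂ (POPUC.matG n (α t) (τ t)) → (0 < deriv θ t ↔
        POPUC.form n α τ ζ s p₀ (Complex.exp (θ t * Complex.I)) t < 0) := by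
      intro t ht hS
      obtain ⟨c, hc, hform⟩ := POPUC.exists_form_eq (hα' t (hJI ht)) (hτ' t (hJI ht))
        (hcoef t (hJI ht)).1 (hcoef t (hJI ht)).2 hζ hs hp₀ (hd t ht) (he t ht) hS
      -- The form is the real number `-(c θ')` with `c > 0`, so the inequality in `ℂ` is one between
      -- reals.
      rw [hform, ← Complex.ofReal_zero, Complex.real_lt_real, neg_lt_zero, mul_pos_iff_of_pos_left hc]
    refine ⟨hd, hcrit, fun T hTJ hTc hT => ?_⟩
    refine strictMonoOn_of_deriv_pos hTc.convex (hθ.1.mono hTJ) fun t ht => ?_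
    have htT := interior_subset ht
    exact (hcrit t (hTJ htT) (hT t htT).1).2 (hT t htT).2
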